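/- Conventions. For a finite set $T$ and a function $\psi\colon T\to\mathbb R/\mathbb Z$ put $G(\psi)=\sum_{t\in T}e^{2\pi i\psi(t)}$; if $G(\psi)\neq0$, the phase $\beta(\psi)\in\mathbb R/\mathbb Z$ is defined by $G(\psi)=|G(\psi)|\,e^{2\pi i\beta(\psi)}$. A quadratic function on an abelian group $T$ is a function $\psi\colon T\to\mathbb R/\mathbb Z$ such that $\psi(ax)=a^2\psi(x)$ for all $a\in\mathbb Z$, $x\in T$, and such that $b_\psi(x,y)=\psi(x+y)-\psi(x)-\psi(y)$ is bilinear (if $T$ is finite, $\psi$ automatically takes values in $\mathbb Q/\mathbb Z$). It is tame if $\psi(t)=0$ for every $t\in T$ with $b_\psi(t,s)=0$ for all $s\in T$. For a symmetric bilinear form $B\colon V\times V\to\mathbb Z$ on a finitely generated free abelian group $V$, let $\sigma(B)$ be the signature of $B\otimes\mathbb R$, and let $B\otimes\psi$ be the quadratic function on $V\otimes T$ with $(B\otimes\psi)(v\otimes x)=B(v,v)\psi(x)$ whose associated bilinear form is $B\otimes b_\psi$. For even $m>0$ let $u_m\colon\mathbb Z/m\to\mathbb Q/\mathbb Z$ be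 the quadratic function $u_m(a)=\frac{a^2}{2m}$, and let $\psi_{B,2}\colon V\otimes\mathbb Z/2\to\mathbb Q/\mathbb Z$ be the function $\psi_{B,2}(v\otimes1)=\frac{B(v,v)}{4}$. Theorem. Let $B$ be a symmetric bilinear form over $\mathbb Z$, on a finitely generated free abelian group $V$, with determinant $\pm1$. (1) For every tame quadratic function $\psi$ on a finite abelian group $T$, the quadratic function $B\otimes\psi$ is tame, $G(\psi)\ne0$ and $G(B\otimes\psi)\neq0$, the phases $\beta(\psi)$ and $\beta(B\otimes\psi)$ lie in $\mathbb Q/\mathbb Z$, and $$\beta(B\otimes\psi)=\sigma(B)\cdot\beta(\psi)\in\mathbb Q/\mathbb Z .$$ (2) For every even $m>0$, $u_m$ is tame, $G(u_m)\neq0$ and $\beta(u_m)=\frac18$. (3) (Brown) $G(\psi_{B,2})\neq0$ and $\beta(\psi_{B,2})=\frac{\sigma(B)}{8}\in\mathbb Q/\mathbb Z$. -/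

import Mathlib

open scoped TensorProduct

namespace GaussSums

universe u v w

noncomputable section

/-! ### Gauss sums, their magnitude and phase

`ℝ/ℤ` is Mathlib's `UnitAddCircle`, and `AddCircle.toCircle x` is `e ^ (2 π i x)` for `x ∈ ℝ/ℤ`. -/

/-- The Gauss sum `G(ψ) = ∑ t, e ^ (2 π i ψ(t))` of a function `ψ : T → ℝ/ℤ` on a finite set. -/
def gauss {T : Type u} [Finite T] (ψ : T → UnitAddCircle) : ℂ :=
  letI := Fintype.ofFinite T
  ∑ t, (AddCircle.toCircle (ψ t) : ℂ)

/-- The phase `β(ψ) ∈ ℝ/ℤ` of the Gauss sum. It is meaningful only where `G(ψ) ≠ 0`, and there it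
is the unique `β` with `G(ψ) = |G(ψ)| e ^ (2 π i β)`: see `eq_phase_iff`. -/
def phase {T : Type u} [Finite T] (ψ : T → UnitAddCircle) : UnitAddCircle :=
  ((Complex.arg (gauss ψ) / (2 * Real.pi) : ℝ) : UnitAddCircle)

theorem gauss_eq_norm_mul_phase {T : Type u} [Finite T] (ψ : T → UnitAddCircle) :
    gauss ψ = (‖gauss ψ‖ : ℂ) * (AddCircle.toCircle (phase ψ) : ℂ) := by
  have h : (AddCircle.toCircle (phase ψ) : ℂ) = Complex.exp (Complex.arg (gauss ψ) * Complex.I) := by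
    rw [phase, AddCircle.toCircle_apply_mk, Circle.coe_exp]
    congr 2
    norm_cast
    field_simp
  rw [h, Complex.norm_mul_exp_arg_mul_I]

theorem eq_phase_iff {T : Type u} [Finite T] (ψ : T → UnitAddCircle) (h : gauss ψ ≠ 0)
    (β : UnitAddCircle) :
    gauss ψ = (‖gauss ψ‖ : ℂ) * (AddCircle.toCircle β : ℂ) ↔ β = phase ψ := by
  constructor
  · intro hβ
    have h1 := hβ.symm.trans (gauss_eq_norm_mul_phase ψ)
    have h2 := mul_left_cancel₀ (by exact_mod_cast norm_ne_zero_iff.mpr h) h1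
    exact AddCircle.injective_toCircle one_ne_zero (Circle.ext h2)
  · rintro rfl
    exact gauss_eq_norm_mul_phase ψ

/-- The subset `ℚ/ℤ` of `ℝ/ℤ`. -/
def ratModInt : Set UnitAddCircle :=
  {x | ∃ q : ℚ, x = ((q : ℝ) : UnitAddCircle)}

/-! ### Quadratic functions

A function `ψ : T → ℝ/ℤ` on an abelian group with `ψ (a x) = a² ψ(x)` for all integers `a` and with
`b(x, y) = ψ(x + y) - ψ(x) - ψ(y)` bilinear is exactly a `QuadraticMap ℤ T UnitAddCircle`; the
associated bilinear form `b` is `QuadraticMap.polar ψ`. -/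

/-- `ψ` is tame if it vanishes on the radical `T^⊥` of its associated bilinear form. -/
def IsTame {T : Type u} [AddCommGroup T] (ψ : QuadraticMap ℤ T UnitAddCircle) : Prop :=
  ∀ t : T, (∀ s : T, QuadraticMap.polar ψ t s = 0) → ψ t = 0

/-! ### The tensor product `B ⊗ ψ` -/

section Tensor

variable {V : Type u} [AddCommGroup V] {T : Type v} [AddCommGroup T]

instance finite_tensor [Module.Free ℤ V] [Module.Finite ℤ V] [Finite T] : Finite (V ⊗[ℤ] T) := by
  classical
  exact Finite.of_equiv (Module.Free.ChooseBasisIndex ℤ V → T)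
    ((Finsupp.linearEquivFunOnFinite ℤ T _).symm.trans
      (TensorProduct.equivFinsuppOfBasisLeft (R := ℤ) (N := T)
        (Module.Free.chooseBasis ℤ V)).symm).toEquiv

variable {N : Type w} [AddCommGroup N]

/-- `Q` is a tensor product of `B` and `ψ`: it is given by `v ⊗ x ↦ B(v, v) ψ(x)` on pure tensors,
and its associated bilinear form is the tensor product of `B` and the one of `ψ`. -/
def IsTensor (B : LinearMap.BilinForm ℤ V) (ψ : QuadraticMap ℤ T N)
    (Q : QuadraticMap ℤ (V ⊗[ℤ] T) N) : Prop :=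
  (∀ (v : V) (x : T), Q (v ⊗ₜ[ℤ] x) = B v v • ψ x) ∧
  ∀ (v w : V) (x y : T),
    QuadraticMap.polar Q (v ⊗ₜ[ℤ] x) (w ⊗ₜ[ℤ] y) = B v w • QuadraticMap.polar ψ x y

theorem IsTensor.unique {B : LinearMap.BilinForm ℤ V} {ψ : QuadraticMap ℤ T N}
    {Q₁ Q₂ : QuadraticMap ℤ (V ⊗[ℤ] T) N} (h₁ : IsTensor B ψ Q₁) (h₂ : IsTensor B ψ Q₂) :
    Q₁ = Q₂ := by
  have hp : Q₁.polarBilin = Q₂.polarBilin := by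
    apply TensorProduct.ext'
    intro v x
    apply TensorProduct.ext'
    intro w y
    exact (h₁.2 v w x y).trans (h₂.2 v w x y).symm
  ext z
  induction z using TensorProduct.induction_on with
  | zero => simp
  | tmul v x => rw [h₁.1, h₂.1]
  | add a b ha hb =>
    have h := LinearMap.congr_fun₂ hp a b
    simp only [QuadraticMap.polarBilin_apply_apply] at h
    rw [QuadraticMap.map_add Q₁, QuadraticMap.map_add Q₂, ha, hb, h]

theorem sum_diag_add_sum_lt {ι : Type*} [Fintype ι] [LinearOrder ι] (M : ι → ι → ℤ)
    (hM : ∀ i j, M i j = M j i) (v w : ι → ℤ) :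
    ∑ i, M i i * (v i * w i) +
      ∑ i, ∑ j, (if i < j then M i j else 0) * (v i * w j + w i * v j) =
    ∑ i, ∑ j, M i j * (v i * w j) := by
  have h1 : ∑ i, ∑ j, (if i < j then M i j else 0) * (w i * v j) =
      ∑ i, ∑ j, (if j < i then M i j else 0) * (v i * w j) := by
    rw [Finset.sum_comm]
    refine Finset.sum_congr rfl fun i _ => Finset.sum_congr rfl fun j _ => ?_
    rw [hM j i]
    ring
  have h2 : ∑ i, M i i * (v i * w i) =
      ∑ i, ∑ j, (if i = j then M i j else 0) * (v i * w j) := by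
    refine Finset.sum_congr rfl fun i _ => ?_
    simp [ite_mul]
  simp only [mul_add, Finset.sum_add_distrib]
  rw [h1, h2]
  simp only [← Finset.sum_add_distrib]
  refine Finset.sum_congr rfl fun i _ => Finset.sum_congr rfl fun j _ => ?_
  rcases lt_trichotomy i j with h | h | h
  · simp [h, h.ne, h.not_gt]
  · simp [h]
  · simp [h, h.ne', h.not_gt]

variable [Module.Free ℤ V] [Module.Finite ℤ V]

theorem exists_isTensor (B : LinearMap.BilinForm ℤ V) (hB : B.IsSymm) (ψ : QuadraticMap ℤ T N) :
    ∃ Q, IsTensor B ψ Q := by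
  classical
  let b := Module.Free.chooseBasis ℤ V
  let _ : LinearOrder (Module.Free.ChooseBasisIndex ℤ V) :=
    IsWellOrder.linearOrder WellOrderingRel
  let c : Module.Free.ChooseBasisIndex ℤ V → V ⊗[ℤ] T →ₗ[ℤ] T := fun i =>
    (TensorProduct.lid ℤ T).toLinearMap ∘ₗ LinearMap.rTensor T (b.coord i)
  have hc : ∀ i v x, c i (v ⊗ₜ[ℤ] x) = b.repr v i • x := by
    intro i v x
    change TensorProduct.lid ℤ T (LinearMap.rTensor T (b.coord i) (v ⊗ₜ[ℤ] x)) = _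
    rw [LinearMap.rTensor_tmul, TensorProduct.lid_tmul]
    rfl
  have hBsum : ∀ v w, ∑ i, ∑ j, B (b i) (b j) * (b.repr v i * b.repr w j) = B v w := by
    intro v w
    conv_rhs => rw [← b.sum_repr v, ← b.sum_repr w]
    simp only [map_sum, LinearMap.sum_apply, map_smul, LinearMap.smul_apply, smul_eq_mul]
    rw [Finset.sum_comm]
    refine Finset.sum_congr rfl fun i _ => ?_
    rw [Finset.mul_sum]
    refine Finset.sum_congr rfl fun j _ => ?_
    ring
  have key := fun v w => (sum_diag_add_sum_lt (fun i j => B (b i) (b j))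
    (fun i j => hB.eq (b i) (b j)) (b.repr v) (b.repr w)).trans (hBsum v w)
  let Q : QuadraticMap ℤ (V ⊗[ℤ] T) N :=
    ∑ i, B (b i) (b i) • ψ.comp (c i) +
      ∑ i, ∑ j, (if i < j then B (b i) (b j) else 0) •
        LinearMap.BilinMap.toQuadraticMap (ψ.polarBilin.compl₁₂ (c i) (c j))
  have hQ : ∀ z, Q z = ∑ i, B (b i) (b i) • ψ (c i z) +
      ∑ i, ∑ j, (if i < j then B (b i) (b j) else 0) •
        QuadraticMap.polar ψ (c i z) (c j z) := by
    intro z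
    simp only [Q, _root_.add_apply, sum_apply, _root_.smul_apply,
      QuadraticMap.comp_apply, LinearMap.BilinMap.toQuadraticMap_apply, LinearMap.compl₁₂_apply,
      QuadraticMap.polarBilin_apply_apply]
  have hpol : ∀ z z', QuadraticMap.polar Q z z' =
      ∑ i, B (b i) (b i) • QuadraticMap.polar ψ (c i z) (c i z') +
      ∑ i, ∑ j, (if i < j then B (b i) (b j) else 0) •
        (QuadraticMap.polar ψ (c i z) (c j z') + QuadraticMap.polar ψ (c i z') (c j z)) := by
    intro z z'
    rw [QuadraticMap.polar, hQ, hQ, hQ]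
    rw [add_sub_add_comm, add_sub_add_comm]
    simp only [← Finset.sum_sub_distrib, ← smul_sub]
    congr 1
    · refine Finset.sum_congr rfl fun i _ => ?_
      rw [map_add, QuadraticMap.polar]
    · refine Finset.sum_congr rfl fun i _ => Finset.sum_congr rfl fun j _ => ?_
      congr 1
      simp only [map_add, QuadraticMap.polar_add_left, QuadraticMap.polar_add_right]
      abel
  refine ⟨Q, fun v x => ?_, fun v w x y => ?_⟩
  · rw [hQ, ← key v v, add_smul, Finset.sum_smul, Finset.sum_smul]
    simp only [Finset.sum_smul, hc]
    congr 1
    · refine Finset.sum_congr rfl fun i _ => ?_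
      rw [QuadraticMap.map_smul, ← mul_smul]
    · refine Finset.sum_congr rfl fun i _ => Finset.sum_congr rfl fun j _ => ?_
      rw [QuadraticMap.polar_smul_left, QuadraticMap.polar_smul_right, QuadraticMap.polar_self,
        ← natCast_zsmul, ← mul_smul, ← mul_smul, ← mul_smul]
      congr 1
      push_cast
      ring
  · rw [hpol, ← key v w, add_smul, Finset.sum_smul, Finset.sum_smul]
    simp only [Finset.sum_smul, hc]
    congr 1
    · refine Finset.sum_congr rfl fun i _ => ?_
      rw [QuadraticMap.polar_smul_left, QuadraticMap.polar_smul_right, ← mul_smul, ← mul_smul,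
        mul_assoc]
    · refine Finset.sum_congr rfl fun i _ => Finset.sum_congr rfl fun j _ => ?_
      simp only [QuadraticMap.polar_smul_left, QuadraticMap.polar_smul_right]
      rw [QuadraticMap.polar_comm ψ y x]
      simp only [← mul_smul, ← add_smul]
      congr 1
      ring

/-- The quadratic function `B ⊗ ψ` on `V ⊗ T`, for a symmetric integral form `B` on `V` and a
quadratic function `ψ` on `T`. -/
def tensor (B : LinearMap.BilinForm ℤ V) (hB : B.IsSymm) (ψ : QuadraticMap ℤ T N) :
    QuadraticMap ℤ (V ⊗[ℤ] T) N :=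
  (exists_isTensor B hB ψ).choose

theorem isTensor_tensor (B : LinearMap.BilinForm ℤ V) (hB : B.IsSymm) (ψ : QuadraticMap ℤ T N) :
    IsTensor B ψ (tensor B hB ψ) :=
  (exists_isTensor B hB ψ).choose_spec

end Tensor

/-- The signature `σ(B)`: the maximal dimension of a positive definite subspace of `V ⊗ ℝ` minus the
maximal dimension of a negative definite one. -/
def signature {V : Type u} [AddCommGroup V] (B : LinearMap.BilinForm ℤ V) : ℤ :=
  (sigPos (LinearMap.BilinMap.toQuadraticMap (LinearMap.BilinForm.baseChange ℝ B)) : ℤ) -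
    (sigNeg (LinearMap.BilinMap.toQuadraticMap (LinearMap.BilinForm.baseChange ℝ B)) : ℤ)

/-! ### The functions `u_m` and `ψ_{B,m}` -/

theorem half_sq_congr {m : ℕ} [NeZero m] (hm : Even m) (a b : ℤ) (h : (a : ZMod m) = b) :
    (((a : ℝ) ^ 2 / (2 * m) : ℝ) : UnitAddCircle) =
      (((b : ℝ) ^ 2 / (2 * m) : ℝ) : UnitAddCircle) := by
  obtain ⟨k, hk⟩ := (ZMod.intCast_eq_intCast_iff_dvd_sub a b m).mp h
  obtain ⟨l, hl⟩ := hm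
  obtain rfl : b = a + m * k := by linarith
  have hm0 : (m : ℝ) ≠ 0 := NeZero.ne _
  have hl' : (m : ℝ) = 2 * l := by rw [hl]; push_cast; ring
  have h2 : (((a + m * k : ℤ) : ℝ) ^ 2 / (2 * m) : ℝ) =
      (a : ℝ) ^ 2 / (2 * m) + ((a * k + l * k ^ 2 : ℤ) : ℝ) := by
    push_cast
    field_simp
    rw [hl']
    ring
  have h3 : (((a * k + l * k ^ 2 : ℤ) : ℝ) : UnitAddCircle) = 0 :=
    (AddCircle.coe_eq_zero_iff (1 : ℝ)).mpr ⟨a * k + l * k ^ 2, by simp⟩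
  rw [h2, AddCircle.coe_add, h3, add_zero]

theorem polar_half_sq {m : ℕ} [NeZero m] (hm : Even m) (x y : ZMod m) :
    QuadraticMap.polar (fun a : ZMod m => (((a.val : ℝ) ^ 2 / (2 * m) : ℝ) : UnitAddCircle)) x y =
      ZMod.toAddCircle (x * y) := by
  obtain ⟨a, rfl⟩ := ZMod.intCast_surjective x
  obtain ⟨b, rfl⟩ := ZMod.intCast_surjective y
  have h1 := half_sq_congr hm (((a : ZMod m) + (b : ZMod m)).val : ℤ) (a + b) (by simp)
  have h2 := half_sq_congr hm ((a : ZMod m).val : ℤ) a (by simp)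
  have h3 := half_sq_congr hm ((b : ZMod m).val : ℤ) b (by simp)
  have hm0 : (m : ℝ) ≠ 0 := NeZero.ne _
  rw [Int.cast_natCast] at h1 h2 h3
  rw [QuadraticMap.polar, h1, h2, h3, ← Int.cast_mul, ZMod.toAddCircle_intCast,
    ← AddCircle.coe_sub, ← AddCircle.coe_sub]
  congr 1
  push_cast
  field_simp
  ring

/-- For even `m > 0`, the quadratic function `u_m : ℤ/m → ℝ/ℤ` with `u_m(a) = a² / (2m)`, so
that `u_m(1) = 1 / (2m)`. -/
def uForm (m : ℕ) [NeZero m] (hm : Even m) : QuadraticMap ℤ (ZMod m) UnitAddCircle :=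
  QuadraticMap.ofPolar (fun a => (((a.val : ℝ) ^ 2 / (2 * m) : ℝ) : UnitAddCircle))
    (by
      intro k a
      obtain ⟨a, rfl⟩ := ZMod.intCast_surjective a
      have h1 := half_sq_congr hm ((k • (a : ZMod m)).val : ℤ) (k * a) (by simp)
      have h2 := half_sq_congr hm ((a : ZMod m).val : ℤ) a (by simp)
      rw [Int.cast_natCast] at h1 h2
      rw [h1, h2, ← AddCircle.coe_zsmul]
      congr 1
      rw [zsmul_eq_mul]
      push_cast
      ring)
    (by
      intro x x' y
      rw [polar_half_sq hm, polar_half_sq hm, polar_half_sq hm, add_mul, map_add])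
    (by
      intro k x y
      rw [polar_half_sq hm, polar_half_sq hm, smul_mul_assoc, map_zsmul])

theorem uForm_intCast (m : ℕ) [NeZero m] (hm : Even m) (a : ℤ) :
    uForm m hm (a : ZMod m) = (((a : ℝ) ^ 2 / (2 * m) : ℝ) : UnitAddCircle) := by
  have h := half_sq_congr hm ((a : ZMod m).val : ℤ) a (by simp)
  push_cast at h
  exact h

theorem tmul_one_surjective (V : Type u) [AddCommGroup V] (m : ℕ) :
    Function.Surjective fun v : V => v ⊗ₜ[ℤ] (1 : ZMod m) := by
  intro z
  induction z using TensorProduct.induction_on with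
  | zero => exact ⟨0, by simp⟩
  | tmul v x =>
    obtain ⟨k, rfl⟩ := ZMod.intCast_surjective x
    exact ⟨k • v, by simp [TensorProduct.smul_tmul]⟩
  | add a b ha hb =>
    obtain ⟨v, rfl⟩ := ha
    obtain ⟨w, rfl⟩ := hb
    exact ⟨v + w, by simp [TensorProduct.add_tmul]⟩

/-- The function `ψ_{B,m} : V ⊗ ℤ/m → ℝ/ℤ`, `ψ_{B,m}(x) = B(x, x) / (2m)`, where on the right `x` is
replaced by any `v ∈ V` that reduces to it. For symmetric `B` and even `m > 0` the value does not
depend on `v`: see `reductionForm_tmul_one`. -/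
def reductionForm {V : Type u} [AddCommGroup V] (B : LinearMap.BilinForm ℤ V) (m : ℕ)
    (x : V ⊗[ℤ] ZMod m) : UnitAddCircle :=
  (((B (Function.surjInv (tmul_one_surjective V m) x) (Function.surjInv (tmul_one_surjective V m) x)
    : ℤ) / (2 * m) : ℝ) : UnitAddCircle)

theorem reductionForm_tmul_one {V : Type u} [AddCommGroup V] [Module.Free ℤ V] [Module.Finite ℤ V]
    (B : LinearMap.BilinForm ℤ V) (hB : B.IsSymm) (m : ℕ) [NeZero m] (hm : Even m) (v : V) :
    reductionForm B m (v ⊗ₜ[ℤ] 1) = (((B v v : ℤ) / (2 * m) : ℝ) : UnitAddCircle) := by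
  have key : ∀ w : V, tensor B hB (uForm m hm) (w ⊗ₜ[ℤ] 1) =
      (((B w w : ℤ) / (2 * m) : ℝ) : UnitAddCircle) := by
    intro w
    have h := uForm_intCast m hm 1
    rw [Int.cast_one] at h
    rw [(isTensor_tensor B hB (uForm m hm)).1 w 1, h, ← AddCircle.coe_zsmul]
    congr 1
    rw [zsmul_eq_mul]
    push_cast
    ring
  rw [reductionForm, ← key, ← key]
  congr 1
  exact Function.surjInv_eq (tmul_one_surjective V m) (v ⊗ₜ[ℤ] 1)

end

end GaussSums

open scoped ComplexConjugate

namespace GaussSums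

/-! Write u for the direction G(ψ)/|G(ψ)|. A frame is an orthogonal basis of a sublattice of finite
index in V. If its norms d_i are prime to the exponent of T, passing to the sublattice does not
change V ⊗ T, so G(B ⊗ ψ) = ∏ G(d_i ψ) (`IsFrame.gauss_isTensor`). Two frames of one diagonal form
therefore give a relation between the sums G(dψ) (`IsFrame.prod_gauss_eq`). These relations suffice:
no classification of ψ is needed. Splitting T into primary parts reduces everything to T a p-group.

For p odd, solving ax² + by² = 1 modulo p gives G(aψ)G(bψ) = G(ψ)G(abψ). So the direction of ∏ G(d_i
ψ) depends only on the rank n and on ∏ d_i, which is det B = (-1)^k up to a square, where σ(B) = n -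
2k. The case a = b = -1 gives u⁴ = 1, and the two exponents agree modulo 4 (`phaseLaw_odd_prime`).

For p = 2 the form may be even, so a summand ⟨1⟩ is added to obtain a frame with odd norms. The sum
G(dψ) depends only on d modulo 8, G(-ψ) is the conjugate of G(ψ), and G(5ψ) = ±G(ψ). The possible
signs cancel because ∏ d_i is ±1 modulo 8. Hence G(B ⊗ ψ) has direction u^(s-1) with s = ∑ χ₄(d_i),
an exponent that does not involve ψ. Since u⁸ = 1, only s - 1 modulo 8 matters. It is read off from
one test case, ψ = u_2, where u is a primitive eighth root of unity and Brown's formula supplies the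
exponent σ(B) (`phaseLaw_two`).

The analytic input is G(u_m) = √m e^(πi/4), obtained from the theta series near 1/m. Brown's formula
follows from it (`gauss_reductionForm`). A frame embeds V modulo a sublattice into a sum of groups
ℤ/2d_i carrying forms ±u_(2|d_i|), whose Gauss sum has phase σ(B)/8; restricting that sum to an
orthogonal complement turns it into a positive multiple of G(ψ_{B,2}). -/

/-- The form `B` is nondegenerate modulo `p`. -/
def NondegMod {V : Type*} [AddCommGroup V] (p : ℤ) (B : LinearMap.BilinForm ℤ V) : Prop :=
  ∀ x, (∀ y, p ∣ B x y) → ∃ z, x = p • z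

/-- A family of pairwise orthogonal anisotropic vectors whose common orthogonal is zero. -/
structure IsFrame {V : Type*} [AddCommGroup V] {ι : Type*} (B : LinearMap.BilinForm ℤ V)
    (w : ι → V) : Prop where
  orth : ∀ i j, i ≠ j → B (w i) (w j) = 0
  ne : ∀ i, B (w i) (w i) ≠ 0
  complete : ∀ x, (∀ i, B (w i) x = 0) → x = 0

/-! ### Existence of frames with norms prime to p -/

section Frames

variable {V : Type*} [AddCommGroup V]

theorem eq_zero_of_forall_dvd [Module.Free ℤ V] {p : ℤ} (hp : ¬ IsUnit p)
    (h : ∀ x : V, ∃ z, x = p • z) (x : V) : x = 0 := by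
  let b := Module.Free.chooseBasis ℤ V
  have hE : IsEmpty (Module.Free.ChooseBasisIndex ℤ V) := by
    refine ⟨fun i => hp ?_⟩
    obtain ⟨z, hz⟩ := h (b i)
    have h1 := congrArg (fun y => b.repr y i) hz
    simp only [Module.Basis.repr_self, map_smul, Finsupp.single_eq_same, Finsupp.smul_apply,
      smul_eq_mul] at h1
    exact IsUnit.of_mul_eq_one _ h1.symm
  exact b.ext_elem fun i => hE.elim i

variable {B : LinearMap.BilinForm ℤ V} {p : ℤ}

theorem not_isUnit_of_zero_or_prime (hp : p = 0 ∨ Prime p) : ¬ IsUnit p := by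
  rcases hp with rfl | hp
  · simp
  · exact hp.not_isUnit

theorem dvd_or_dvd_of_zero_or_prime (hp : p = 0 ∨ Prime p) {a b : ℤ} (h : p ∣ a * b) :
    p ∣ a ∨ p ∣ b := by
  rcases hp with rfl | hp
  · simpa using h
  · exact hp.dvd_or_dvd h

/-- The projection to the orthogonal complement of `v`, multiplied by `B v v`. -/
theorem smul_sub_mem_ker (v x : V) :
    B v v • x - B v x • v ∈ LinearMap.ker (B v) := by
  rw [LinearMap.mem_ker, map_sub, map_smul, map_smul, smul_eq_mul, smul_eq_mul]
  ring

/-- Orthogonal projection along v is integral after multiplication by B(v, v), and that factor can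
be cancelled modulo p. So a vector of the complement that pairs into p with the complement pairs
into p with all of V. -/
theorem NondegMod.ker (hp : p = 0 ∨ Prime p) (hB : B.IsSymm) (h : NondegMod p B) {v : V}
    (hv : ¬ p ∣ B v v) : NondegMod p (B.restrict (LinearMap.ker (B v))) := by
  rintro ⟨x, hx⟩ hxy
  obtain ⟨z, hz⟩ := h x (by
    intro y
    have h1 := hxy ⟨_, smul_sub_mem_ker v y⟩
    rw [LinearMap.BilinForm.restrict_apply] at h1
    simp only [LinearMap.domRestrict_apply, map_sub, map_smul] at h1
    have h2 : B x v = 0 := by rw [← hB.eq]; simpa using hx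
    rw [h2, smul_zero, sub_zero, smul_eq_mul] at h1
    exact (dvd_or_dvd_of_zero_or_prime hp h1).resolve_left hv)
  by_cases hp0 : p = 0
  · subst hp0
    rw [zero_smul] at hz
    exact ⟨0, Subtype.ext (by simpa using hz)⟩
  · refine ⟨⟨z, ?_⟩, Subtype.ext hz⟩
    have h3 : p * B v z = 0 := by
      rw [← smul_eq_mul, ← map_smul, ← hz]
      exact hx
    exact (mul_eq_zero.mp h3).resolve_left hp0

theorem IsFrame.cons (hB : B.IsSymm) {v : V} (hv : B v v ≠ 0) {n : ℕ}
    {w : Fin n → LinearMap.ker (B v)} (hw : IsFrame (B.restrict (LinearMap.ker (B v))) w) :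
    IsFrame B (Fin.cons v (fun i => (w i : V)) : Fin (n + 1) → V) where
  orth := by
    intro i j
    refine Fin.cases ?_ (fun i => ?_) i <;> refine Fin.cases ?_ (fun j => ?_) j
    · simp
    · intro _
      simp
    · intro _
      rw [← hB.eq]
      simp
    · intro hij
      have := hw.orth i j (by simpa using hij)
      simpa using this
  ne := by
    intro i
    refine Fin.cases ?_ (fun i => ?_) i
    · simpa using hv
    · simpa using hw.ne i
  complete := by
    intro x hx
    have hx0 : x ∈ LinearMap.ker (B v) := by simpa using hx 0
    have := hw.complete ⟨x, hx0⟩ fun i => by simpa using hx i.succ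
    simpa using this

theorem finrank_ker_lt [Module.Finite ℤ V] {v : V} (hv : B v v ≠ 0) :
    Module.finrank ℤ (LinearMap.ker (B v)) < Module.finrank ℤ V := by
  have h1 := Submodule.finrank_quotient_add_finrank (LinearMap.ker (B v))
  have h2 : Module.finrank ℤ (V ⧸ LinearMap.ker (B v)) ≠ 0 := by
    rw [(B v).quotKerEquivRange.finrank_eq]
    intro h0
    have := (Module.finrank_pos_iff (R := ℤ)).mpr
      (⟨⟨⟨B v v, v, rfl⟩, 0, fun h => hv (congrArg Subtype.val h)⟩⟩ :
        Nontrivial (LinearMap.range (B v)))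
    omega
  omega

/-- Polarization: if p divided every norm it would divide 2B(x, y), hence B(x, y), and nondegeneracy
would give V = pV. -/
theorem exists_not_dvd_self [Module.Free ℤ V] (hp : p = 0 ∨ Prime p) (h2 : ¬ p ∣ 2) (hB : B.IsSymm)
    (h : NondegMod p B) (hV : ∃ x : V, x ≠ 0) : ∃ v, ¬ p ∣ B v v := by
  by_contra! hc
  obtain ⟨x, hx⟩ := hV
  refine hx (eq_zero_of_forall_dvd (not_isUnit_of_zero_or_prime hp) (fun x => h x fun y => ?_) x)
  have h1 := hc (x + y)
  have h3 : B (x + y) (x + y) = B x x + B y y + 2 * B x y := by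
    simp only [map_add, LinearMap.add_apply]
    rw [← hB.eq y x]
    ring
  rw [h3, dvd_add_right (dvd_add (hc x) (hc y))] at h1
  exact (dvd_or_dvd_of_zero_or_prime hp h1).resolve_left h2

variable [Module.Free ℤ V] [Module.Finite ℤ V]

/-- Gram–Schmidt without division, by induction on the rank. The case p = 0 diagonalizes over ℚ; an
odd prime p diagonalizes over the localization at p. -/
theorem exists_frame_not_dvd (hp : p = 0 ∨ Prime p) (h2 : ¬ p ∣ 2) (hB : B.IsSymm)
    (h : NondegMod p B) :
    ∃ (n : ℕ) (w : Fin n → V), IsFrame B w ∧ ∀ i, ¬ p ∣ B (w i) (w i) := by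
  induction hn : Module.finrank ℤ V using Nat.strong_induction_on generalizing V with
  | _ n ih =>
    by_cases hV : ∃ x : V, x ≠ 0
    · obtain ⟨v, hv⟩ := exists_not_dvd_self hp h2 hB h hV
      have hv0 : B v v ≠ 0 := fun h0 => hv (h0 ▸ dvd_zero p)
      obtain ⟨k, w, hw, hwp⟩ := ih _ (hn ▸ finrank_ker_lt hv0)
        (B := B.restrict (LinearMap.ker (B v))) ⟨fun x y => hB.eq x y⟩ (h.ker hp hB hv) rfl
      refine ⟨k + 1, _, hw.cons hB hv0, fun i => ?_⟩
      refine Fin.cases ?_ (fun i => ?_) i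
      · simpa using hv
      · simpa using hwp i
    · push Not at hV
      exact ⟨0, Fin.elim0, ⟨fun i => i.elim0, fun i => i.elim0, fun x _ => hV x⟩, fun i => i.elim0⟩

/-- For p = 2 polarization fails and the complement of an odd vector may be even, which would stop
the induction. The vector v has to be chosen so that a nonzero complement is odd again. -/
theorem exists_odd_ker_odd (hB : B.IsSymm) (h : NondegMod 2 B) (hV : ∃ v, ¬ 2 ∣ B v v) :
    ∃ v, ¬ 2 ∣ B v v ∧ ((∀ x ∈ LinearMap.ker (B v), x = 0) ∨
      ∃ x ∈ LinearMap.ker (B v), ¬ 2 ∣ B x x) := by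
  obtain ⟨v, hv⟩ := hV
  by_cases h1 : ∃ x ∈ LinearMap.ker (B v), ¬ 2 ∣ B x x
  · exact ⟨v, hv, Or.inr h1⟩
  push Not at h1
  have hK := h.ker (Or.inr Int.prime_two) hB hv
  by_cases h2 : ∃ a b : LinearMap.ker (B v), ¬ 2 ∣ B a b
  · obtain ⟨⟨a, ha⟩, ⟨b, hb⟩, hab⟩ := h2
    have haa := h1 a ha
    have hbb := h1 b hb
    rw [LinearMap.mem_ker] at ha hb
    have hav : B a v = 0 := by rw [← hB.eq]; simpa using ha
    have hbv : B b v = 0 := by rw [← hB.eq]; simpa using hb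
    have hba : B b a = B a b := by rw [← hB.eq]
    have h3 : B (v + a) (v + a) = B v v + B a a := by simp [ha, hav]
    have hodd : ¬ 2 ∣ B (v + a) (v + a) := by rw [h3]; omega
    -- With the complement even and B(a, b) odd, v + a is still odd. The scaled projection of b has
    -- norm c²B(b, b) - cB(a, b)², which is odd because c is odd and B(b, b) is even.
    refine ⟨v + a, hodd, Or.inr ⟨_, smul_sub_mem_ker (v + a) b, ?_⟩⟩
    set c := B (v + a) (v + a) with hc
    have h4 : B (v + a) b = B a b := by simp [hb]
    have h5 : B b (v + a) = B a b := by simp [hbv, hba]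
    have h6 : B (c • b - B (v + a) b • (v + a)) (c • b - B (v + a) b • (v + a)) =
        c * c * B b b - B a b * B a b * c := by
      rw [h4]
      simp only [map_sub, map_smul, LinearMap.sub_apply, LinearMap.smul_apply, h4, h5, ← hc,
        smul_eq_mul]
      ring
    rw [h6]
    simp only at hab
    have e1 : Even (B b b) := (even_iff_two_dvd).mpr hbb
    rw [← even_iff_two_dvd] at hab hodd ⊢
    rw [Int.even_sub, Int.even_mul, Int.even_mul (m := B a b * B a b), Int.even_mul (m := B a b)]
    tauto
  · push Not at h2
    -- Here B is divisible by 2 on the complement, so nondegeneracy modulo 2 forces the complement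
    -- to vanish.
    refine ⟨v, hv, Or.inl fun x hx => ?_⟩
    have := eq_zero_of_forall_dvd (not_isUnit_of_zero_or_prime (Or.inr Int.prime_two))
      (fun a => hK a fun b => h2 a b) ⟨x, hx⟩
    simpa using this

theorem exists_frame_odd (hB : B.IsSymm) (h : NondegMod 2 B) (hV : ∃ v, ¬ 2 ∣ B v v) :
    ∃ (n : ℕ) (w : Fin n → V), IsFrame B w ∧ ∀ i, ¬ 2 ∣ B (w i) (w i) := by
  induction hn : Module.finrank ℤ V using Nat.strong_induction_on generalizing V with
  | _ n ih =>
    obtain ⟨v, hv, hv'⟩ := exists_odd_ker_odd hB h hV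
    have hv0 : B v v ≠ 0 := fun h0 => hv (h0 ▸ dvd_zero 2)
    have key : ∃ (n : ℕ) (w : Fin n → LinearMap.ker (B v)),
        IsFrame (B.restrict (LinearMap.ker (B v))) w ∧ ∀ i, ¬ 2 ∣ B (w i) (w i) := by
      rcases hv' with hv' | ⟨x, hx, hxx⟩
      · exact ⟨0, Fin.elim0, ⟨fun i => i.elim0, fun i => i.elim0,
          fun x _ => Subtype.ext (hv' x x.2)⟩, fun i => i.elim0⟩
      · exact ih _ (hn ▸ finrank_ker_lt hv0)
          (B := B.restrict (LinearMap.ker (B v))) ⟨fun x y => hB.eq x y⟩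
          (h.ker (Or.inr Int.prime_two) hB hv) ⟨⟨x, hx⟩, hxx⟩ rfl
    obtain ⟨k, w, hw, hwp⟩ := key
    refine ⟨k + 1, _, hw.cons hB hv0, fun i => ?_⟩
    refine Fin.cases ?_ (fun i => ?_) i
    · simpa using hv
    · simpa using hwp i

end Frames

/-! ### The sublattice spanned by a frame: index, determinant, signature -/

section FrameMap

variable {V : Type*} [AddCommGroup V] {ι : Type*} [Fintype ι]
  {B : LinearMap.BilinForm ℤ V} {w : ι → V}

/-- The map `ℤ^ι → V` given by a family of vectors. -/
noncomputable def frameMap (w : ι → V) : (ι → ℤ) →ₗ[ℤ] V := Fintype.linearCombination ℤ w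

theorem frameMap_apply (w : ι → V) (c : ι → ℤ) : frameMap w c = ∑ i, c i • w i := rfl

/-- The product of the norms of the vectors of a family. -/
noncomputable def frameDet (B : LinearMap.BilinForm ℤ V) (w : ι → V) : ℤ := ∏ i, B (w i) (w i)

/-- For a frame, the inverse of `frameMap w` multiplied by `frameDet B w`. -/
noncomputable def frameCoord [DecidableEq ι] (B : LinearMap.BilinForm ℤ V) (w : ι → V) :
    V →ₗ[ℤ] (ι → ℤ) :=
  LinearMap.pi fun i => (∏ j ∈ Finset.univ.erase i, B (w j) (w j)) • B (w i)

theorem IsFrame.apply_frameMap (hw : IsFrame B w) (i : ι) (c : ι → ℤ) :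
    B (w i) (frameMap w c) = c i * B (w i) (w i) := by
  classical
  rw [frameMap_apply, map_sum, Finset.sum_eq_single i]
  · simp
  · intro j _ hj
    simp [hw.orth i j hj.symm]
  · simp

theorem IsFrame.frameMap_frameMap (hw : IsFrame B w) (a c : ι → ℤ) :
    B (frameMap w a) (frameMap w c) = ∑ i, B (w i) (w i) * (a i * c i) := by
  conv_lhs => rw [frameMap_apply w a]
  simp only [map_sum, map_smul, LinearMap.sum_apply, LinearMap.smul_apply, smul_eq_mul,
    hw.apply_frameMap]
  exact Finset.sum_congr rfl fun i _ => by ring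

theorem IsFrame.frameDet_ne_zero (hw : IsFrame B w) : frameDet B w ≠ 0 :=
  Finset.prod_ne_zero_iff.mpr fun i _ => hw.ne i

variable [DecidableEq ι]

theorem IsFrame.frameCoord_frameMap (hw : IsFrame B w) (c : ι → ℤ) :
    frameCoord B w (frameMap w c) = frameDet B w • c := by
  ext i
  simp only [frameCoord, LinearMap.pi_apply, LinearMap.smul_apply, hw.apply_frameMap, Pi.smul_apply,
    smul_eq_mul, frameDet]
  rw [← Finset.mul_prod_erase _ _ (Finset.mem_univ i)]
  ring

theorem IsFrame.frameMap_frameCoord (hw : IsFrame B w) (x : V) :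
    frameMap w (frameCoord B w x) = frameDet B w • x := by
  rw [← sub_eq_zero]
  refine hw.complete _ fun i => ?_
  rw [map_sub, hw.apply_frameMap, map_smul, frameDet,
    ← Finset.mul_prod_erase _ _ (Finset.mem_univ i)]
  simp only [frameCoord, LinearMap.pi_apply, LinearMap.smul_apply, smul_eq_mul]
  ring

theorem IsFrame.injective_frameMap (hw : IsFrame B w) : Function.Injective (frameMap w) := by
  intro a b h
  have h1 := congrArg (frameCoord B w) h
  rw [hw.frameCoord_frameMap, hw.frameCoord_frameMap] at h1
  exact smul_right_injective _ hw.frameDet_ne_zero h1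

theorem IsFrame.parseval (hw : IsFrame B w) (x y : V) :
    (B x y : ℚ) = ∑ i, (B (w i) x : ℚ) * B (w i) y / B (w i) (w i) := by
  have h1 := congrArg (fun z => B z y) (hw.frameMap_frameCoord x)
  simp only [frameMap_apply, map_sum, map_smul, LinearMap.sum_apply, LinearMap.smul_apply,
    smul_eq_mul, frameCoord, LinearMap.pi_apply] at h1
  have h2 : (frameDet B w : ℚ) ≠ 0 := by exact_mod_cast hw.frameDet_ne_zero
  have h3 : (frameDet B w : ℚ) * B x y =
      frameDet B w * ∑ i, (B (w i) x : ℚ) * B (w i) y / B (w i) (w i) := by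
    rw [← Int.cast_mul, ← h1, Finset.mul_sum]
    push_cast
    refine Finset.sum_congr rfl fun i _ => ?_
    have h4 : (B (w i) (w i) : ℚ) ≠ 0 := by exact_mod_cast hw.ne i
    rw [frameDet, ← Finset.mul_prod_erase _ _ (Finset.mem_univ i)]
    push_cast
    field_simp
  exact mul_left_cancel₀ h2 h3

/-- `frameMap` and `frameCoord` are both injective, so the ranks agree. The Gram matrix of the frame
is then PᵀMP with P square, and k is det P. -/
theorem IsFrame.frameDet_eq [Module.Free ℤ V] [Module.Finite ℤ V] (hw : IsFrame B w) {κ : Type*}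
    [Fintype κ] [DecidableEq κ] (e : Module.Basis κ ℤ V) :
    Fintype.card ι = Fintype.card κ ∧
    ∃ k : ℤ, frameDet B w = k ^ 2 * (LinearMap.BilinForm.toMatrix e B).det := by
  have hcard : Fintype.card ι = Fintype.card κ := by
    have h1 := LinearMap.finrank_le_finrank_of_injective hw.injective_frameMap
    have hinj : Function.Injective (frameCoord B w) := by
      intro a b h
      have h1 := congrArg (frameMap w) h
      rw [hw.frameMap_frameCoord, hw.frameMap_frameCoord] at h1
      exact smul_right_injective _ hw.frameDet_ne_zero h1
    have h2 := LinearMap.finrank_le_finrank_of_injective hinj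
    rw [Module.finrank_fintype_fun_eq_card, Module.finrank_eq_card_basis e] at h1 h2
    exact le_antisymm h1 h2
  refine ⟨hcard, ?_⟩
  let σ : ι ≃ κ := Fintype.equivOfCardEq hcard
  let c : Module.Basis κ ℤ (ι → ℤ) := (Pi.basisFun ℤ ι).reindex σ
  have h1 := LinearMap.BilinForm.toMatrix_comp e c B (frameMap w) (frameMap w)
  have h2 : LinearMap.BilinForm.toMatrix c (B.comp (frameMap w) (frameMap w)) =
      Matrix.diagonal fun k => B (w (σ.symm k)) (w (σ.symm k)) := by
    ext i j
    rw [LinearMap.BilinForm.toMatrix_apply, LinearMap.BilinForm.comp_apply, hw.frameMap_frameMap,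
      Finset.sum_eq_single (σ.symm i), Matrix.diagonal_apply]
    · simp only [c, Module.Basis.reindex_apply, Pi.basisFun_apply, Pi.single_eq_same, one_mul,
        Pi.single_apply, EmbeddingLike.apply_eq_iff_eq]
      split_ifs <;> simp
    · intro k _ hk
      simp [c, hk]
    · simp
  have h3 := congrArg Matrix.det h1
  rw [h2, Matrix.det_diagonal, Matrix.det_mul, Matrix.det_mul, Matrix.det_transpose,
    Equiv.prod_comp σ.symm (fun i => B (w i) (w i))] at h3
  exact ⟨_, by rw [frameDet, h3]; ring⟩

/-- The signature can be computed from a frame. -/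
theorem IsFrame.signature_eq [Module.Free ℤ V] [Module.Finite ℤ V] (hw : IsFrame B w) :
    signature B = ∑ i, (B (w i) (w i)).sign := by
  classical
  set d : ι → ℤ := fun i => B (w i) (w i) with hd
  have hd0 : ∀ i, (d i : ℝ) ≠ 0 := fun i => by exact_mod_cast hw.ne i
  have hD : (frameDet B w : ℝ) ≠ 0 := by exact_mod_cast hw.frameDet_ne_zero
  let φ : (ι → ℝ) →ₗ[ℝ] ℝ ⊗[ℤ] V :=
    Fintype.linearCombination ℝ (fun i => (1 : ℝ) ⊗ₜ[ℤ] w i)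
  have hφ : ∀ c, φ c = ∑ i, c i • ((1 : ℝ) ⊗ₜ[ℤ] w i) := fun c => rfl
  have hB1 : ∀ i c, LinearMap.BilinForm.baseChange ℝ B ((1 : ℝ) ⊗ₜ[ℤ] w i) (φ c) = c i * d i := by
    intro i c
    rw [hφ, map_sum, Finset.sum_eq_single i]
    · rw [map_smul, LinearMap.BilinForm.baseChange_tmul]
      simp [hd]
    · intro j _ hj
      rw [map_smul, LinearMap.BilinForm.baseChange_tmul, hw.orth i j hj.symm]
      simp
    · simp
  have hinj : Function.Injective φ := by
    intro a b h
    ext i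
    have h1 := hB1 i a
    rw [h, hB1 i b] at h1
    exact (mul_right_cancel₀ (hd0 i) h1).symm
  have hsurj : Function.Surjective φ := by
    rw [← LinearMap.range_eq_top, eq_top_iff]
    rintro x -
    induction x using TensorProduct.induction_on with
    | zero => exact zero_mem _
    | add a b ha hb => exact add_mem ha hb
    | tmul r v =>
      -- Over ℝ the factor `frameDet B w` can be divided out, so `frameCoord` yields honest
      -- coordinates.
      refine ⟨fun i => (r / frameDet B w) * (frameCoord B w v i : ℝ), ?_⟩
      have h1 : r ⊗ₜ[ℤ] v = (r / frameDet B w) ⊗ₜ[ℤ] (frameDet B w • v) := by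
        rw [← TensorProduct.smul_tmul, zsmul_eq_mul, mul_div_cancel₀ _ hD]
      rw [hφ, h1, ← hw.frameMap_frameCoord, frameMap_apply, TensorProduct.tmul_sum]
      refine Finset.sum_congr rfl fun i _ => ?_
      rw [← TensorProduct.smul_tmul, TensorProduct.smul_tmul']
      congr 1
      rw [zsmul_eq_mul, smul_eq_mul]
      ring
  let E : (ι → ℝ) ≃ₗ[ℝ] ℝ ⊗[ℤ] V := LinearEquiv.ofBijective φ ⟨hinj, hsurj⟩
  have hQ : QuadraticMap.Equivalent (LinearMap.BilinMap.toQuadraticMap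
      (LinearMap.BilinForm.baseChange ℝ B))
      (QuadraticMap.weightedSumSquares ℝ fun i => (d i : ℝ)) := by
    refine QuadraticMap.Equivalent.symm ⟨⟨E, fun c => ?_⟩⟩
    change LinearMap.BilinForm.baseChange ℝ B (φ c) (φ c) = _
    rw [QuadraticMap.weightedSumSquares_apply]
    have h2 : ∀ z, LinearMap.BilinForm.baseChange ℝ B (φ c) z =
        ∑ i, c i * LinearMap.BilinForm.baseChange ℝ B ((1 : ℝ) ⊗ₜ[ℤ] w i) z := by
      intro z
      rw [hφ, map_sum, LinearMap.sum_apply]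
      refine Finset.sum_congr rfl fun i _ => ?_
      rw [map_smul, LinearMap.smul_apply, smul_eq_mul]
    rw [h2]
    refine Finset.sum_congr rfl fun i _ => ?_
    rw [hB1, smul_eq_mul]
    ring
  rw [signature, QuadraticForm.sigPos_of_equiv_weightedSumSquares hQ,
    QuadraticForm.sigNeg_of_equiv_weightedSumSquares hQ]
  have h1 : ∀ i, (d i).sign = (if 0 < d i then 1 else 0) - (if d i < 0 then 1 else 0) := by
    intro i
    rcases lt_trichotomy (d i) 0 with h | h | h
    · simp [Int.sign_eq_neg_one_of_neg h, h, h.not_gt]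
    · simp [h]
    · simp [Int.sign_eq_one_of_pos h, h, h.not_gt]
  simp only [hd] at h1
  simp only [h1, Finset.sum_sub_distrib, Finset.sum_boole]
  rw [Set.ncard_eq_toFinset_card', Set.ncard_eq_toFinset_card']
  simp [hd]

end FrameMap

/-! ### Unimodularity, and the determinant versus the signature -/

/-- The form `B` is unimodular: every functional is of the form `B x`, for a unique `x`. -/
def IsUnimodular {V : Type*} [AddCommGroup V] (B : LinearMap.BilinForm ℤ V) : Prop :=
  Function.Bijective B

section Unimodular

variable {V : Type*} [AddCommGroup V] {B : LinearMap.BilinForm ℤ V}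

theorem isUnimodular_of_det {ι : Type*} [Fintype ι] [DecidableEq ι] (e : Module.Basis ι ℤ V)
    (hdet : (LinearMap.BilinForm.toMatrix e B).det = 1 ∨
      (LinearMap.BilinForm.toMatrix e B).det = -1) : IsUnimodular B := by
  have h1 : LinearMap.toMatrix e e.dualBasis B =
      (LinearMap.BilinForm.toMatrix e B).transpose := by
    ext i j
    rw [LinearMap.toMatrix_apply, Module.Basis.dualBasis_repr, Matrix.transpose_apply,
      LinearMap.BilinForm.toMatrix_apply]
  have h2 : IsUnit (LinearMap.toMatrix e e.dualBasis B).det := by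
    rw [h1, Matrix.det_transpose]
    rcases hdet with h | h <;> rw [h]
    · exact isUnit_one
    · exact isUnit_one.neg
  have h3 := (LinearEquiv.ofIsUnitDet h2).bijective
  exact h3

/-- If p ≠ 0 divides the functional B(x, ·), then the quotient is again a functional B(z, ·), and x
= pz by injectivity. -/
theorem IsUnimodular.nondegMod [Module.Free ℤ V] (h : IsUnimodular B) (p : ℤ) :
    NondegMod p B := by
  intro x hx
  by_cases hp : p = 0
  · subst hp
    refine ⟨0, h.1 ?_⟩
    ext y
    simpa using hx y
  obtain ⟨z, hz⟩ := h.2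
    { toFun := fun y => B x y / p
      map_add' := fun a b => by rw [map_add, Int.add_ediv_of_dvd_left (hx a)]
      map_smul' := fun k a => by
        rw [map_smul, smul_eq_mul, RingHom.id_apply, smul_eq_mul, Int.mul_ediv_assoc _ (hx a)] }
  refine ⟨z, h.1 ?_⟩
  ext y
  rw [map_smul, hz]
  exact (Int.mul_ediv_cancel' (hx y)).symm

/-- The number k counts the negative norms in a frame. The determinant is the sign of the product of
the norms, because the two differ by a nonzero square. -/
theorem exists_signature_eq [Module.Free ℤ V] [Module.Finite ℤ V] (hB : B.IsSymm)
    {ι : Type*} [Fintype ι] [DecidableEq ι] (e : Module.Basis ι ℤ V)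
    (hdet : (LinearMap.BilinForm.toMatrix e B).det = 1 ∨
      (LinearMap.BilinForm.toMatrix e B).det = -1) :
    ∃ k : ℕ, signature B = Fintype.card ι - 2 * k ∧
      (LinearMap.BilinForm.toMatrix e B).det = (-1) ^ k := by
  obtain ⟨n, w, hw, -⟩ := exists_frame_not_dvd (Or.inl rfl) (by simp) hB
    ((isUnimodular_of_det e hdet).nondegMod 0)
  obtain ⟨hcard, c, hc⟩ := hw.frameDet_eq e
  have hsign : (frameDet B w).sign = (LinearMap.BilinForm.toMatrix e B).det := by
    have hc0 : 0 < c ^ 2 := by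
      have : c ≠ 0 := by
        rintro rfl
        exact hw.frameDet_ne_zero (by simpa using hc)
      positivity
    rw [hc, Int.sign_mul, Int.sign_eq_one_of_pos hc0, one_mul]
    rcases hdet with h | h <;> rw [h] <;> rfl
  have hs : ∀ i, (B (w i) (w i)).sign = if B (w i) (w i) < 0 then -1 else 1 := by
    intro i
    split_ifs with h
    · exact Int.sign_eq_neg_one_of_neg h
    · exact Int.sign_eq_one_of_pos (lt_of_le_of_ne (not_lt.mp h) (hw.ne i).symm)
  refine ⟨(Finset.univ.filter fun i => B (w i) (w i) < 0).card, ?_, ?_⟩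
  · rw [hw.signature_eq, ← hcard]
    have h1 : ∀ i, (B (w i) (w i)).sign = 1 - 2 * if B (w i) (w i) < 0 then 1 else 0 := by
      intro i
      rw [hs]
      split_ifs <;> norm_num
    simp only [h1, Finset.sum_sub_distrib, ← Finset.mul_sum, Finset.sum_boole]
    simp
  · have h1 : ∀ s : Finset (Fin n), (∏ i ∈ s, B (w i) (w i)).sign =
        ∏ i ∈ s, (B (w i) (w i)).sign := by
      intro s
      induction s using Finset.induction_on with
      | empty => rfl
      | insert a s ha ih => rw [Finset.prod_insert ha, Finset.prod_insert ha, Int.sign_mul, ih]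
    rw [← hsign, frameDet, h1]
    simp only [hs]
    rw [Finset.prod_ite]
    simp

end Unimodular

/-! ### General properties of Gauss sums -/

section Basic

theorem gauss_eq {T : Type*} [Fintype T] (ψ : T → UnitAddCircle) :
    gauss ψ = ∑ t, (AddCircle.toCircle (ψ t) : ℂ) := by
  rw [gauss]
  congr!

theorem gauss_comp_equiv {S T : Type*} [Finite S] [Finite T] (e : S ≃ T) (ψ : T → UnitAddCircle) :
    gauss (fun s => ψ (e s)) = gauss ψ := by
  cases nonempty_fintype S
  cases nonempty_fintype T
  rw [gauss_eq, gauss_eq]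
  exact Equiv.sum_comp e fun t => (AddCircle.toCircle (ψ t) : ℂ)

theorem gauss_prod {S T : Type*} [Finite S] [Finite T] (f : S → UnitAddCircle)
    (g : T → UnitAddCircle) :
    gauss (fun x : S × T => f x.1 + g x.2) = gauss f * gauss g := by
  cases nonempty_fintype S
  cases nonempty_fintype T
  rw [gauss_eq, gauss_eq, gauss_eq, Finset.sum_mul_sum, Fintype.sum_prod_type]
  simp [AddCircle.toCircle_add]

theorem toCircle_sum {ι : Type*} (s : Finset ι) (f : ι → UnitAddCircle) :
    (AddCircle.toCircle (∑ i ∈ s, f i) : ℂ) = ∏ i ∈ s, (AddCircle.toCircle (f i) : ℂ) := by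
  classical
  induction s using Finset.induction_on with
  | empty => simp
  | insert a s ha ih =>
    rw [Finset.sum_insert ha, Finset.prod_insert ha, AddCircle.toCircle_add, Circle.coe_mul, ih]

theorem gauss_pi {ι : Type*} [Fintype ι] {S : ι → Type*} [∀ i, Finite (S i)]
    (f : ∀ i, S i → UnitAddCircle) :
    gauss (fun x : ∀ i, S i => ∑ i, f i (x i)) = ∏ i, gauss (f i) := by
  classical
  have := fun i => Fintype.ofFinite (S i)
  simp only [gauss_eq, toCircle_sum]
  rw [Finset.prod_univ_sum, Fintype.piFinset_univ]

theorem gauss_neg {T : Type*} [Finite T] (ψ : T → UnitAddCircle) :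
    gauss (fun t => -ψ t) = conj (gauss ψ) := by
  cases nonempty_fintype T
  rw [gauss_eq, gauss_eq, map_sum]
  simp only [AddCircle.toCircle_neg, Circle.coe_inv_eq_conj]

theorem toCircle_eq_one_iff {x : UnitAddCircle} : (AddCircle.toCircle x : ℂ) = 1 ↔ x = 0 := by
  rw [← Circle.coe_one, Circle.coe_inj, ← AddCircle.toCircle_zero (T := (1 : ℝ))]
  exact (AddCircle.injective_toCircle one_ne_zero).eq_iff

/-- Orthogonality of characters. -/
theorem sum_toCircle_hom {H : Type*} [AddCommGroup H] [Fintype H] (φ : H →+ UnitAddCircle)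
    [Decidable (∀ h, φ h = 0)] :
    ∑ h, (AddCircle.toCircle (φ h) : ℂ) = if ∀ h, φ h = 0 then (Fintype.card H : ℂ) else 0 := by
  split_ifs with h
  · simp [h]
  · push Not at h
    obtain ⟨a, ha⟩ := h
    have h1 : (AddCircle.toCircle (φ a) : ℂ) * ∑ h, (AddCircle.toCircle (φ h) : ℂ) =
        ∑ h, (AddCircle.toCircle (φ h) : ℂ) := by
      rw [Finset.mul_sum]
      conv_rhs => rw [← Equiv.sum_comp (Equiv.addLeft a)]
      simp [AddCircle.toCircle_add]
    have h2 : (AddCircle.toCircle (φ a) : ℂ) ≠ 1 := fun h => ha (toCircle_eq_one_iff.mp h)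
    have h3 : ((AddCircle.toCircle (φ a) : ℂ) - 1) *
        ∑ h, (AddCircle.toCircle (φ h) : ℂ) = 0 := by
      rw [sub_mul, h1, one_mul, sub_self]
    exact (mul_eq_zero.mp h3).resolve_left (sub_ne_zero.mpr h2)

open Classical in
/-- The Gauss sum can be restricted to the orthogonal of a subgroup on which the function
vanishes. -/
theorem gauss_eq_sum_orthogonal {A : Type*} [AddCommGroup A] [Fintype A]
    (φ : QuadraticMap ℤ A UnitAddCircle) (H : AddSubgroup A) (hH : ∀ h ∈ H, φ h = 0) :
    gauss φ = ∑ x ∈ Finset.univ.filter (fun x => ∀ h ∈ H, QuadraticMap.polar φ x h = 0),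
      (AddCircle.toCircle (φ x) : ℂ) := by
  have h0 : (Fintype.card H : ℂ) ≠ 0 := by
    exact_mod_cast Fintype.card_ne_zero
  refine mul_left_cancel₀ h0 ?_
  have h1 : ∀ h : H, ∑ x, (AddCircle.toCircle (φ (x + h)) : ℂ) = gauss φ := fun h => by
    rw [gauss_eq]
    exact Equiv.sum_comp (Equiv.addRight (h : A)) fun x => (AddCircle.toCircle (φ x) : ℂ)
  -- Average over translations by H. As φ vanishes on H, translating x by h only multiplies its term
  -- by the character b(x, h), and the sum over H kills every x not orthogonal to H.
  have h2 : (Fintype.card H : ℂ) * gauss φ =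
      ∑ h : H, ∑ x, (AddCircle.toCircle (φ (x + h)) : ℂ) := by
    simp [h1]
  rw [h2, Finset.sum_comm, Finset.sum_filter, Finset.mul_sum]
  refine Finset.sum_congr rfl fun x _ => ?_
  have h3 : ∀ h : H, (AddCircle.toCircle (φ (x + h)) : ℂ) = (AddCircle.toCircle (φ x) : ℂ) *
      (AddCircle.toCircle ((φ.polarBilin x).toAddMonoidHom.comp H.subtype h) : ℂ) := by
    intro h
    have h4 : φ (x + h) = φ x + QuadraticMap.polar φ x h := by
      rw [QuadraticMap.map_add φ, hH h h.2, add_zero]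
    rw [h4, AddCircle.toCircle_add, Circle.coe_mul]
    rfl
  simp only [h3]
  rw [← Finset.mul_sum, sum_toCircle_hom]
  have h5 : (∀ h : H, (φ.polarBilin x).toAddMonoidHom.comp H.subtype h = 0) ↔
      ∀ h ∈ H, QuadraticMap.polar φ x h = 0 :=
    ⟨fun h a ha => h ⟨a, ha⟩, fun h a => h a a.2⟩
  simp only [h5]
  split_ifs
  · ring
  · simp

/-- Expanding |G(ψ)|² and summing the bilinear characters leaves |T| times the sum of e^(2πiψ) over
the radical. Tameness makes each of those terms 1. -/
theorem IsTame.gauss_ne_zero {T : Type*} [AddCommGroup T] [Finite T]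
    {ψ : QuadraticMap ℤ T UnitAddCircle} (h : IsTame ψ) : gauss ψ ≠ 0 := by
  classical
  cases nonempty_fintype T
  have h1 : gauss ψ * conj (gauss ψ) =
      ∑ z, ∑ y, (AddCircle.toCircle (ψ z + QuadraticMap.polar ψ z y) : ℂ) := by
    rw [gauss_eq, map_sum, Finset.sum_mul_sum, Finset.sum_comm]
    conv_rhs => rw [Finset.sum_comm]
    refine Finset.sum_congr rfl fun y _ => ?_
    rw [← Equiv.sum_comp (Equiv.addRight y)]
    refine Finset.sum_congr rfl fun z _ => ?_
    rw [← Circle.coe_inv_eq_conj, ← AddCircle.toCircle_neg, ← Circle.coe_mul,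
      ← AddCircle.toCircle_add, Equiv.coe_addRight]
    simp only
    rw [QuadraticMap.map_add ψ]
    congr 2
    abel
  have h2 : ∀ z, ∑ y, (AddCircle.toCircle (ψ z + QuadraticMap.polar ψ z y) : ℂ) =
      if ∀ y, QuadraticMap.polar ψ z y = 0 then (Fintype.card T : ℂ) else 0 := by
    intro z
    have := sum_toCircle_hom (ψ.polarBilin z).toAddMonoidHom
    simp only [LinearMap.toAddMonoidHom_coe, QuadraticMap.polarBilin_apply_apply] at this
    simp only [AddCircle.toCircle_add, Circle.coe_mul]
    rw [← Finset.mul_sum, this]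
    split_ifs with hz
    · rw [h z hz]
      simp
    · simp
  intro h0
  rw [h0, zero_mul] at h1
  simp only [h2] at h1
  rw [← Finset.sum_filter, Finset.sum_const, nsmul_eq_mul] at h1
  have h3 := (mul_eq_zero.mp h1.symm)
  rcases h3 with h3 | h3
  · have h4 : (Finset.univ.filter fun z => ∀ y, QuadraticMap.polar ψ z y = 0).card = 0 := by
      exact_mod_cast h3
    rw [Finset.card_eq_zero] at h4
    have : (0 : T) ∈ Finset.univ.filter fun z => ∀ y, QuadraticMap.polar ψ z y = 0 := by
      simp
    rw [h4] at this
    simp at this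
  · exact Fintype.card_ne_zero (α := T) (by exact_mod_cast h3)

theorem map_sum_of_orthogonal {M N ι : Type*} [AddCommGroup M] [AddCommGroup N]
    (Q : QuadraticMap ℤ M N) (s : Finset ι) (x : ι → M)
    (h : ∀ i j, i ≠ j → QuadraticMap.polar Q (x i) (x j) = 0) :
    Q (∑ i ∈ s, x i) = ∑ i ∈ s, Q (x i) := by
  classical
  induction s using Finset.induction_on with
  | empty => simp
  | insert a s ha ih =>
    rw [Finset.sum_insert ha, Finset.sum_insert ha, QuadraticMap.map_add Q, ih]
    have h1 : QuadraticMap.polar Q (x a) (∑ i ∈ s, x i) = 0 := by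
      rw [← QuadraticMap.polarBilin_apply_apply, map_sum]
      refine Finset.sum_eq_zero fun i hi => h a i ?_
      rintro rfl
      exact ha hi
    rw [h1, add_zero]

theorem eq_zero_of_zsmul_of_isCoprime {M : Type*} [AddCommGroup M] {a b : ℤ} (h : IsCoprime a b)
    {x : M} (ha : a • x = 0) (hb : b • x = 0) : x = 0 := by
  obtain ⟨u, v, huv⟩ := h
  rw [← one_zsmul x, ← huv, add_smul, mul_smul, mul_smul, ha, hb]
  simp

theorem exists_zsmul_of_isCoprime {M : Type*} [AddCommGroup M] {a b : ℤ} (h : IsCoprime a b)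
    {x : M} (hb : b • x = 0) : ∃ y, a • y = x := by
  obtain ⟨u, v, huv⟩ := h
  refine ⟨u • x, ?_⟩
  conv_rhs => rw [← one_zsmul x, ← huv, add_smul, mul_smul, mul_smul, hb]
  rw [smul_zero, add_zero, smul_comm]

end Basic

/-! ### Gauss sums and tameness of B ⊗ ψ -/

section Tensor

variable {V : Type*} [AddCommGroup V] {T : Type*} [AddCommGroup T]

/-- The map `V ⊗ T → T` given by a functional on `V`. -/
noncomputable def contract (T : Type*) [AddCommGroup T] (g : V →ₗ[ℤ] ℤ) : V ⊗[ℤ] T →ₗ[ℤ] T :=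
  (TensorProduct.lid ℤ T).toLinearMap ∘ₗ LinearMap.rTensor T g

theorem contract_tmul (g : V →ₗ[ℤ] ℤ) (v : V) (t : T) :
    contract T g (v ⊗ₜ[ℤ] t) = g v • t := by
  change TensorProduct.lid ℤ T (LinearMap.rTensor T g (v ⊗ₜ[ℤ] t)) = _
  rw [LinearMap.rTensor_tmul, TensorProduct.lid_tmul]

theorem tensor_zsmul_eq_zero {N : ℤ} (hN : ∀ t : T, N • t = 0) (x : V ⊗[ℤ] T) : N • x = 0 := by
  induction x using TensorProduct.induction_on with
  | zero => simp
  | tmul v t => rw [← TensorProduct.tmul_smul, hN, TensorProduct.tmul_zero]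
  | add a b ha hb => rw [smul_add, ha, hb, add_zero]

/-- Contracting with the frame coordinates inverts this map up to the factor `frameDet B w`, which
acts invertibly on groups killed by N. -/
theorem IsFrame.bijective_sum_tmul {ι : Type*} [Fintype ι] {B : LinearMap.BilinForm ℤ V}
    {w : ι → V} (hw : IsFrame B w) {N : ℤ} (hN : ∀ t : T, N • t = 0)
    (hcop : IsCoprime (frameDet B w) N) :
    Function.Bijective fun t : ι → T => ∑ i, w i ⊗ₜ[ℤ] t i := by
  classical
  let g : ι → V →ₗ[ℤ] ℤ := fun i => LinearMap.proj i ∘ₗ frameCoord B w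
  have hg : ∀ i j, g i (w j) = if j = i then frameDet B w else 0 := by
    intro i j
    have h1 : w j = frameMap w (Pi.single j 1) := by
      rw [frameMap_apply, Finset.sum_eq_single j]
      · simp
      · intro k _ hk
        simp [hk]
      · simp
    simp only [g, LinearMap.comp_apply, LinearMap.proj_apply]
    rw [h1, hw.frameCoord_frameMap, Pi.smul_apply, Pi.single_apply]
    simp [eq_comm]
  have h1 : ∀ (t : ι → T) (i : ι), contract T (g i) (∑ j, w j ⊗ₜ[ℤ] t j) =
      frameDet B w • t i := by
    intro t i
    rw [map_sum]
    simp only [contract_tmul, hg, ite_smul, zero_smul]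
    simp
  have h2 : ∀ x : V ⊗[ℤ] T, ∑ i, w i ⊗ₜ[ℤ] contract T (g i) x = frameDet B w • x := by
    intro x
    induction x using TensorProduct.induction_on with
    | zero => simp
    | tmul v t =>
      simp only [contract_tmul, ← TensorProduct.smul_tmul]
      rw [← TensorProduct.sum_tmul, TensorProduct.smul_tmul', ← hw.frameMap_frameCoord]
      rfl
    | add a b ha hb =>
      simp only [map_add, TensorProduct.tmul_add, Finset.sum_add_distrib, smul_add, ha, hb]
  constructor
  · intro s t hst
    ext i
    rw [← sub_eq_zero]
    refine eq_zero_of_zsmul_of_isCoprime hcop ?_ (hN _)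
    rw [smul_sub, ← h1, ← h1, sub_eq_zero]
    exact congrArg _ hst
  · intro x
    obtain ⟨y, hy⟩ := exists_zsmul_of_isCoprime hcop (tensor_zsmul_eq_zero hN x)
    exact ⟨fun i => contract T (g i) y, (h2 y).trans hy⟩

variable [Module.Free ℤ V] [Module.Finite ℤ V]

/-- The Gauss sum of `B ⊗ ψ` computed from a frame of index coprime to the exponent of `T`. -/
theorem IsFrame.gauss_isTensor [Finite T] {ι : Type*} [Fintype ι] {B : LinearMap.BilinForm ℤ V}
    {w : ι → V} (hw : IsFrame B w) {N : ℤ} (hN : ∀ t : T, N • t = 0)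
    (hcop : IsCoprime (frameDet B w) N) {ψ : QuadraticMap ℤ T UnitAddCircle}
    {Q : QuadraticMap ℤ (V ⊗[ℤ] T) UnitAddCircle} (hQ : IsTensor B ψ Q) :
    gauss Q = ∏ i, gauss (fun t => B (w i) (w i) • ψ t) := by
  rw [← gauss_comp_equiv (Equiv.ofBijective _ (hw.bijective_sum_tmul hN hcop)), ← gauss_pi]
  congr 1
  ext t
  rw [Equiv.ofBijective_apply, map_sum_of_orthogonal]
  · simp only [hQ.1]
  · intro i j hij
    rw [hQ.2, hw.orth i j hij, zero_smul]

/-- Write x = ∑ e_i ⊗ t_i. Each coordinate functional is B(v, ·) for some v, so pairing x with v ⊗ s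
puts every t_i in the radical of ψ. The diagonal and the cross terms of Q(x) then both vanish. -/
theorem IsTensor.isTame {B : LinearMap.BilinForm ℤ V} (hB : B.IsSymm) (hU : IsUnimodular B)
    {ψ : QuadraticMap ℤ T UnitAddCircle} (hψ : IsTame ψ)
    {Q : QuadraticMap ℤ (V ⊗[ℤ] T) UnitAddCircle} (hQ : IsTensor B ψ Q) : IsTame Q := by
  intro x hx
  let e := Module.Free.chooseBasis ℤ V
  have h1 : ∀ i (s : T), QuadraticMap.polar ψ (contract T (e.coord i) x) s = 0 := by
    intro i s
    obtain ⟨v, hv⟩ := hU.2 (e.coord i)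
    have h2 : ∀ y : V ⊗[ℤ] T, QuadraticMap.polar Q y (v ⊗ₜ[ℤ] s) =
        QuadraticMap.polar ψ (contract T (e.coord i) y) s := by
      intro y
      induction y using TensorProduct.induction_on with
      | zero => simp
      | tmul u t =>
        rw [hQ.2, contract_tmul, QuadraticMap.polar_smul_left, ← hv, ← hB.eq]
      | add a b ha hb =>
        rw [QuadraticMap.polar_add_left, ha, hb, map_add, QuadraticMap.polar_add_left]
    rw [← h2, hx]
  have h3 : ∀ y : V ⊗[ℤ] T, ∑ i, e i ⊗ₜ[ℤ] contract T (e.coord i) y = y := by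
    intro y
    induction y using TensorProduct.induction_on with
    | zero => simp
    | tmul v t =>
      simp only [contract_tmul, ← TensorProduct.smul_tmul]
      rw [← TensorProduct.sum_tmul]
      simp only [Module.Basis.coord_apply, e.sum_repr]
    | add a b ha hb =>
      simp only [map_add, TensorProduct.tmul_add, Finset.sum_add_distrib, ha, hb]
  rw [← h3 x, map_sum_of_orthogonal]
  · refine Finset.sum_eq_zero fun i _ => ?_
    rw [hQ.1, hψ _ (h1 i), smul_zero]
  · intro i j _
    rw [hQ.2, h1, smul_zero]

end Tensor

/-! ### Directions of complex numbers and phases -/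

section Direction

/-- The direction of a complex number. -/
noncomputable def dir (z : ℂ) : ℂ := z / ‖z‖

theorem dir_mul (z w : ℂ) : dir (z * w) = dir z * dir w := by
  rw [dir, dir, dir, norm_mul]
  push_cast
  rw [mul_div_mul_comm]

theorem dir_pow (z : ℂ) (n : ℕ) : dir (z ^ n) = dir z ^ n := by
  rw [dir, dir, norm_pow]
  push_cast
  rw [div_pow]

theorem dir_conj (z : ℂ) : dir (conj z) = conj (dir z) := by
  simp [dir]

theorem dir_mul_conj {z : ℂ} (hz : z ≠ 0) : dir z * conj (dir z) = 1 := by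
  have : (‖z‖ : ℂ) ≠ 0 := by exact_mod_cast norm_ne_zero_iff.mpr hz
  rw [dir, map_div₀, Complex.conj_ofReal, div_mul_div_comm, Complex.mul_conj, ← Complex.ofReal_mul,
    Complex.normSq_eq_norm_sq, ← sq, div_self]
  exact_mod_cast pow_ne_zero 2 (norm_ne_zero_iff.mpr hz)

theorem conj_dir {z : ℂ} (hz : z ≠ 0) : conj (dir z) = (dir z)⁻¹ :=
  eq_inv_of_mul_eq_one_right (dir_mul_conj hz)

theorem dir_ne_zero {z : ℂ} (hz : z ≠ 0) : dir z ≠ 0 :=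
  left_ne_zero_of_mul_eq_one (dir_mul_conj hz)

theorem dir_ofReal_mul {r : ℝ} (hr : 0 < r) (z : ℂ) : dir (r * z) = dir z := by
  have : (r : ℂ) ≠ 0 := by exact_mod_cast hr.ne'
  rw [dir_mul, dir, Complex.norm_real, Real.norm_of_nonneg hr.le, div_self this, one_mul]

theorem dir_toCircle (x : UnitAddCircle) :
    dir (AddCircle.toCircle x : ℂ) = AddCircle.toCircle x := by
  rw [dir, Circle.norm_coe, Complex.ofReal_one, div_one]

variable {T : Type*} [Finite T] {ψ : T → UnitAddCircle}

theorem toCircle_phase (h : gauss ψ ≠ 0) : (AddCircle.toCircle (phase ψ) : ℂ) = dir (gauss ψ) := by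
  conv_rhs => rw [gauss_eq_norm_mul_phase, dir_ofReal_mul (norm_pos_iff.mpr h), dir_toCircle]

theorem phase_eq_of_dir (h : gauss ψ ≠ 0) {β : UnitAddCircle}
    (hβ : dir (gauss ψ) = AddCircle.toCircle β) : phase ψ = β := by
  rw [← toCircle_phase h] at hβ
  exact AddCircle.injective_toCircle one_ne_zero (Circle.ext hβ)

theorem phase_mem_ratModInt (h : gauss ψ ≠ 0) {n : ℕ} (hn : n ≠ 0) (h1 : dir (gauss ψ) ^ n = 1) :
    phase ψ ∈ ratModInt := by
  rw [← toCircle_phase h, ← Circle.coe_pow, ← AddCircle.toCircle_nsmul, toCircle_eq_one_iff] at h1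
  obtain ⟨x, hx⟩ := QuotientAddGroup.mk_surjective (phase ψ)
  rw [← hx] at h1 ⊢
  change n • ((x : ℝ) : UnitAddCircle) = 0 at h1
  rw [← AddCircle.coe_nsmul, AddCircle.coe_eq_zero_iff] at h1
  obtain ⟨k, hk⟩ := h1
  refine ⟨k / n, ?_⟩
  have h2 : x = ((k / n : ℚ) : ℝ) := by
    have hn' : (n : ℝ) ≠ 0 := by exact_mod_cast hn
    push_cast
    rw [eq_div_iff hn', mul_comm]
    simpa using hk.symm
  rw [← h2]

end Direction

/-! ### The Gauss sum of u_m, by theta series -/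

section Analytic

open Filter Topology Complex

theorem summable_exp_neg_mul_sq {a : ℂ} (ha : 0 < a.re) :
    Summable fun n : ℤ => cexp (-Real.pi * a * (n : ℂ) ^ 2) := by
  have h := (summable_jacobiTheta₂_term_iff 0 (I * a)).mpr (by simpa using ha)
  refine h.congr fun n => ?_
  rw [jacobiTheta₂_term]
  congr 1
  linear_combination (Real.pi * a * (n : ℂ) ^ 2) * I_sq

/-- Only the term n = 0 survives as s tends to infinity; for s ≥ 1 the series is dominated by its
Gaussian factors at s = 1. -/
theorem tendsto_tsum_gaussian (c : ℤ → ℂ) (hc : ∀ n, ‖c n‖ ≤ 1) (h0 : c 0 = 1) :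
    Tendsto (fun s : ℝ => ∑' n : ℤ, c n * cexp (-Real.pi * s * (n : ℂ) ^ 2)) atTop (𝓝 1) := by
  have hnorm : ∀ (s : ℝ) (n : ℤ), ‖cexp (-Real.pi * s * (n : ℂ) ^ 2)‖ =
      Real.exp (-Real.pi * s * (n : ℝ) ^ 2) := by
    intro s n
    rw [norm_exp]
    congr 1
    have : (-Real.pi * s * (n : ℂ) ^ 2 : ℂ) = ((-Real.pi * s * (n : ℝ) ^ 2 : ℝ) : ℂ) := by
      push_cast; rfl
    rw [this, ofReal_re]
  have h1 : (∑' n : ℤ, if n = 0 then (1 : ℂ) else 0) = 1 := tsum_ite_eq 0 _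
  rw [← h1]
  refine tendsto_tsum_of_dominated_convergence
    (bound := fun n : ℤ => ‖cexp (-Real.pi * (1 : ℝ) * (n : ℂ) ^ 2)‖) ?_ ?_ ?_
  · exact (summable_exp_neg_mul_sq (a := (1 : ℝ)) (by simp)).norm
  · intro n
    split_ifs with hn
    · simp [hn, h0]
    · refine squeeze_zero_norm (a := fun s : ℝ => Real.exp (-Real.pi * s * (n : ℝ) ^ 2)) ?_ ?_
      · intro s
        rw [norm_mul, hnorm]
        exact mul_le_of_le_one_left (Real.exp_pos _).le (hc n)
      · refine Real.tendsto_exp_atBot.comp ?_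
        have h2 : (0 : ℝ) < Real.pi * (n : ℝ) ^ 2 := by
          have : (n : ℝ) ≠ 0 := by exact_mod_cast hn
          positivity
        have h3 := (tendsto_id (α := ℝ) (x := atTop)).const_mul_atTop h2
        refine (tendsto_neg_atTop_atBot.comp h3).congr fun s => ?_
        simp only [Function.comp_apply, id]
        ring
  · filter_upwards [eventually_ge_atTop 1] with s hs n
    rw [norm_mul, hnorm, hnorm]
    refine (mul_le_of_le_one_left (Real.exp_pos _).le (hc n)).trans ?_
    refine Real.exp_le_exp.mpr ?_
    have : 0 ≤ Real.pi * (n : ℝ) ^ 2 := by positivity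
    nlinarith

theorem norm_exp_I_mul (x : ℝ) : ‖cexp (x * I)‖ ≤ 1 := (norm_exp_ofReal_mul_I x).le

theorem exp_even_mul {m : ℕ} (hm : Even m) (n : ℤ) : cexp (Real.pi * I * m * n) = 1 := by
  obtain ⟨l, rfl⟩ := hm
  rw [exp_eq_one_iff]
  exact ⟨l * n, by push_cast; ring⟩

variable {m : ℕ} [NeZero m]

theorem re_pos_aux {s : ℝ} (hs : 0 < s) : 0 < (1 / ((m : ℂ) ^ 2 * s) - I / m).re := by
  have h1 : (1 / ((m : ℂ) ^ 2 * s) - I / m) =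
      ((1 / ((m : ℝ) ^ 2 * s) : ℝ) : ℂ) - ((1 / m : ℝ) : ℂ) * I := by
    push_cast
    ring
  have hm0 : (m : ℝ) ≠ 0 := NeZero.ne _
  rw [h1]
  simp only [sub_re, ofReal_re, mul_re, ofReal_im, I_re, I_im]
  have : 0 < 1 / ((m : ℝ) ^ 2 * s) := by positivity
  simpa using this

/-- The theta series near a rational point, split into residue classes. -/
theorem tsum_theta_eq_sum (hm : Even m) {s : ℝ} (hs : 0 < s) :
    ∑' n : ℤ, cexp (-Real.pi * (1 / ((m : ℂ) ^ 2 * s) - I / m) * (n : ℂ) ^ 2) =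
      (s : ℂ) ^ (1 / 2 : ℂ) * ∑ r : Fin m, cexp (Real.pi * I * (r : ℂ) ^ 2 / m) *
        ∑' n : ℤ, cexp ((2 * Real.pi * n * r / m : ℝ) * I) *
          cexp (-Real.pi * s * (n : ℂ) ^ 2) := by
  have hm0 : (m : ℂ) ≠ 0 := NeZero.ne _
  have hs0 : (s : ℂ) ≠ 0 := by exact_mod_cast hs.ne'
  have hsum := summable_exp_neg_mul_sq (re_pos_aux (m := m) hs)
  -- Write n = km + r. As m is even, e^(πi n²/m) depends only on r, and Poisson summation applies to
  -- the remaining Gaussian in k.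
  rw [← (Int.divModEquiv m).symm.tsum_eq, ← (Equiv.prodComm _ _).tsum_eq]
  have hsum' : Summable fun p : Fin m × ℤ => cexp (-Real.pi * (1 / ((m : ℂ) ^ 2 * s) - I / m) *
      (((Int.divModEquiv m).symm (Equiv.prodComm _ _ p) : ℤ) : ℂ) ^ 2) :=
    ((Equiv.prodComm _ _).trans (Int.divModEquiv m).symm).summable_iff.mpr hsum
  rw [Summable.tsum_prod hsum', tsum_fintype, Finset.mul_sum]
  refine Finset.sum_congr rfl fun r _ => ?_
  have h1 : ∀ k : ℤ, cexp (-Real.pi * (1 / ((m : ℂ) ^ 2 * s) - I / m) *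
      (((Int.divModEquiv m).symm (Equiv.prodComm _ _ (r, k)) : ℤ) : ℂ) ^ 2) =
      cexp (Real.pi * I * (r : ℂ) ^ 2 / m) * cexp (-Real.pi / (m ^ 2 * s) * (r : ℂ) ^ 2) *
        cexp (-Real.pi * (1 / s) * (k : ℂ) ^ 2 + 2 * Real.pi * (-r / (m * s)) * k) := by
    intro k
    rw [Equiv.prodComm_apply, Prod.swap_prod_mk, Int.divModEquiv_symm_apply]
    rw [← exp_add, ← exp_add]
    have h2 := exp_even_mul hm (k ^ 2)
    have h3 : cexp (2 * Real.pi * I * ((k * r : ℤ) : ℂ)) = 1 :=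
      exp_eq_one_iff.mpr ⟨k * r, by ring⟩
    have h4 : -Real.pi * (1 / ((m : ℂ) ^ 2 * s) - I / m) * ((k * m + (r : ℕ) : ℤ) : ℂ) ^ 2 =
        (Real.pi * I * (r : ℂ) ^ 2 / m + -Real.pi / (m ^ 2 * s) * (r : ℂ) ^ 2 +
          (-Real.pi * (1 / s) * (k : ℂ) ^ 2 + 2 * Real.pi * (-r / (m * s)) * k)) +
        Real.pi * I * m * ((k ^ 2 : ℤ) : ℂ) + 2 * Real.pi * I * ((k * r : ℤ) : ℂ) := by
      push_cast
      field_simp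
      ring
    rw [h4, exp_add, exp_add, h2, h3, mul_one, mul_one]
  have h5 : ∀ n : ℤ, cexp (-Real.pi / (1 / s) * (n + I * (-r / (m * s))) ^ 2) =
      cexp (Real.pi / (m ^ 2 * s) * (r : ℂ) ^ 2) *
        (cexp ((2 * Real.pi * n * r / m : ℝ) * I) * cexp (-Real.pi * s * (n : ℂ) ^ 2)) := by
    intro n
    rw [← exp_add, ← exp_add]
    congr 1
    push_cast
    field_simp
    linear_combination -(r : ℂ) ^ 2 * I_sq
  have h6 : (1 : ℂ) / (1 / s : ℂ) ^ (1 / 2 : ℂ) = (s : ℂ) ^ (1 / 2 : ℂ) := by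
    rw [one_div (s : ℂ), inv_cpow _ _ (by rw [arg_ofReal_of_nonneg hs.le]; exact Real.pi_pos.ne),
      one_div, inv_inv]
  have h7 : 0 < (1 / s : ℂ).re := by
    rw [← ofReal_one, ← ofReal_div, ofReal_re]
    positivity
  simp only [h1]
  rw [tsum_mul_left, tsum_exp_neg_quadratic h7, h6]
  simp only [h5]
  rw [tsum_mul_left]
  have h8 : cexp (-Real.pi / (m ^ 2 * s) * (r : ℂ) ^ 2) *
      cexp (Real.pi / (m ^ 2 * s) * (r : ℂ) ^ 2) = 1 := by
    rw [← exp_add, exp_eq_one_iff]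
    exact ⟨0, by ring⟩
  linear_combination (cexp (Real.pi * I * (r : ℂ) ^ 2 / m) * (s : ℂ) ^ (1 / 2 : ℂ) *
    ∑' n : ℤ, cexp ((2 * Real.pi * n * r / m : ℝ) * I) *
          cexp (-Real.pi * s * (n : ℂ) ^ 2)) * h8

/-- The theta series near a rational point, transformed twice. -/
theorem tsum_theta_eq_transform (hm : Even m) {s : ℝ} (hs : 0 < s) :
    ∑' n : ℤ, cexp (-Real.pi * (1 / ((m : ℂ) ^ 2 * s) - I / m) * (n : ℂ) ^ 2) =
      1 / (1 / ((m : ℂ) ^ 2 * s) - I / m) ^ (1 / 2 : ℂ) *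
        (1 / (1 / (s + I / m)) ^ (1 / 2 : ℂ) *
        ∑' n : ℤ, cexp ((-(Real.pi * n ^ 2 / m) : ℝ) * I) *
          cexp (-Real.pi * s * (n : ℂ) ^ 2)) := by
  have hm0 : (m : ℂ) ≠ 0 := NeZero.ne _
  have hs0 : (s : ℂ) ≠ 0 := by exact_mod_cast hs.ne'
  have ha := re_pos_aux (m := m) hs
  have ha0 : 1 / ((m : ℂ) ^ 2 * s) - I / m ≠ 0 := fun h => by
    rw [h] at ha
    simp at ha
  have hre : ((s : ℂ) + I / m).re = s := by
    have : (I / m : ℂ) = ((1 / m : ℝ) : ℂ) * I := by push_cast; ring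
    rw [this]
    simp
  have hb0 : (s : ℂ) + I / m ≠ 0 := fun h => by
    rw [h] at hre
    exact hs.ne hre
  have hb : 0 < (1 / ((s : ℂ) + I / m)).re := by
    rw [one_div, inv_re, hre]
    exact div_pos hs (normSq_pos.mpr hb0)
  rw [tsum_exp_neg_mul_int_sq ha]
  have h1 : ∀ n : ℤ, cexp (-Real.pi / (1 / ((m : ℂ) ^ 2 * s) - I / m) * (n : ℂ) ^ 2) =
      cexp (-Real.pi * (1 / (s + I / m)) * (n : ℂ) ^ 2) := by
    intro n
    have h2 := exp_even_mul hm (-n ^ 2)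
    have h3 : -Real.pi / (1 / ((m : ℂ) ^ 2 * s) - I / m) * (n : ℂ) ^ 2 =
        -Real.pi * (1 / (s + I / m)) * (n : ℂ) ^ 2 +
          Real.pi * I * m * ((-n ^ 2 : ℤ) : ℂ) := by
      have h4 : (1 : ℂ) - I * m * s ≠ 0 := by
        intro h
        apply ha0
        field_simp
        linear_combination h
      have h5 : (m : ℂ) * s + I ≠ 0 := by
        intro h
        apply hb0
        field_simp
        linear_combination h
      -- After one inversion the parameter is 1/(s + I/m) up to the shift Im, which is invisible to
      -- the theta series because m is even. Inverting again brings back the Gaussian of parameter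
      -- s.
      have h6 : 1 / (1 / ((m : ℂ) ^ 2 * s) - I / m) = 1 / (s + I / m) + I * m := by
        have e1 : 1 / ((m : ℂ) ^ 2 * s) - I / m = (1 - I * m * s) / (m ^ 2 * s) := by
          field_simp
        have e2 : (s : ℂ) + I / m = (m * s + I) / m := by field_simp
        rw [e1, e2]
        field_simp
        linear_combination (m : ℂ) ^ 2 * s ^ 2 * I_sq + (m : ℂ) * s * I * I_sq - I_sq
      push_cast
      linear_combination -Real.pi * (n : ℂ) ^ 2 * h6
    rw [h3, exp_add, h2, mul_one]
  simp only [h1]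
  rw [tsum_exp_neg_mul_int_sq hb]
  congr 3
  ext n
  rw [← exp_add]
  congr 1
  push_cast
  field_simp
  ring

theorem ofReal_mul_cpow {r : ℝ} (hr : 0 < r) {z : ℂ} (hz : z ≠ 0) (w : ℂ) :
    ((r : ℂ) * z) ^ w = (r : ℂ) ^ w * z ^ w := by
  have hr0 : (r : ℂ) ≠ 0 := by exact_mod_cast hr.ne'
  rw [cpow_def_of_ne_zero (mul_ne_zero hr0 hz), cpow_def_of_ne_zero hr0, cpow_def_of_ne_zero hz,
    log_ofReal_mul hr hz, ← exp_add, ← add_mul, ofReal_log hr.le]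

/-- The quadratic Gauss sum for an even modulus. -/
theorem sum_exp_sq (hm : Even m) :
    ∑ r : Fin m, cexp (Real.pi * I * (r : ℂ) ^ 2 / m) = 1 / (-I / m) ^ (1 / 2 : ℂ) := by
  have hm0 : (m : ℂ) ≠ 0 := NeZero.ne _
  have hmR : 0 < (m : ℝ) := by exact_mod_cast Nat.pos_of_ne_zero (NeZero.ne m)
  have hinv : Tendsto (fun s : ℝ => (1 / s : ℂ)) atTop (𝓝 0) := by
    have := (continuous_ofReal.tendsto 0).comp tendsto_inv_atTop_zero
    rw [ofReal_zero] at this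
    refine this.congr fun s => ?_
    simp
  have hL : Tendsto (fun s : ℝ => ∑ r : Fin m, cexp (Real.pi * I * (r : ℂ) ^ 2 / m) *
      ∑' n : ℤ, cexp ((2 * Real.pi * n * r / m : ℝ) * I) * cexp (-Real.pi * s * (n : ℂ) ^ 2))
      atTop (𝓝 (∑ r : Fin m, cexp (Real.pi * I * (r : ℂ) ^ 2 / m))) := by
    refine tendsto_finsetSum _ fun r _ => ?_
    have := (tendsto_tsum_gaussian (fun n => cexp ((2 * Real.pi * n * r / m : ℝ) * I))
      (fun n => norm_exp_I_mul _) (by simp)).const_mul (cexp (Real.pi * I * (r : ℂ) ^ 2 / m))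
    rwa [mul_one] at this
  have hR : Tendsto (fun s : ℝ => 1 / (1 / (m : ℂ) ^ 2 * (1 / s) - I / m) ^ (1 / 2 : ℂ) *
        (1 / (1 / (1 + I / m * (1 / s))) ^ (1 / 2 : ℂ) *
        ∑' n : ℤ, cexp ((-(Real.pi * n ^ 2 / m) : ℝ) * I) *
          cexp (-Real.pi * s * (n : ℂ) ^ 2))) atTop
      (𝓝 (1 / (1 / (m : ℂ) ^ 2 * 0 - I / m) ^ (1 / 2 : ℂ) *
        (1 / (1 / (1 + I / m * 0)) ^ (1 / 2 : ℂ) * 1))) := by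
    have hslit : 1 / (m : ℂ) ^ 2 * 0 - I / m ∈ slitPlane := by
      have : (1 / (m : ℂ) ^ 2 * 0 - I / m : ℂ) = ((-(1 / m) : ℝ) : ℂ) * I := by push_cast; ring
      rw [this, mem_slitPlane_iff]
      right
      simp [hmR.ne']
    refine Tendsto.mul ?_ (Tendsto.mul ?_ ?_)
    · refine Tendsto.div tendsto_const_nhds ?_ ?_
      · exact ((hinv.const_mul _).sub_const _).cpow tendsto_const_nhds hslit
      · rw [cpow_ne_zero_iff_of_exponent_ne_zero (by norm_num)]
        exact slitPlane_ne_zero hslit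
    · have h1 : Tendsto (fun s : ℝ => (1 / (1 + I / m * (1 / s)) : ℂ)) atTop
          (𝓝 (1 / (1 + I / m * 0))) :=
        Tendsto.div tendsto_const_nhds ((hinv.const_mul _).const_add _) (by simp)
      refine Tendsto.div tendsto_const_nhds (h1.cpow tendsto_const_nhds ?_) ?_
      · simp
      · simp
    · exact tendsto_tsum_gaussian _ (fun n => norm_exp_I_mul _) (by simp)
  -- Both expansions of the theta series, divided by the common growth √s. Letting s tend to
  -- infinity then compares the Gauss sum with an explicit root.
  have hEq : (fun s : ℝ => 1 / (1 / (m : ℂ) ^ 2 * (1 / s) - I / m) ^ (1 / 2 : ℂ) *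
        (1 / (1 / (1 + I / m * (1 / s))) ^ (1 / 2 : ℂ) *
        ∑' n : ℤ, cexp ((-(Real.pi * n ^ 2 / m) : ℝ) * I) *
          cexp (-Real.pi * s * (n : ℂ) ^ 2))) =ᶠ[atTop]
      (fun s : ℝ => ∑ r : Fin m, cexp (Real.pi * I * (r : ℂ) ^ 2 / m) *
      ∑' n : ℤ, cexp ((2 * Real.pi * n * r / m : ℝ) * I) * cexp (-Real.pi * s * (n : ℂ) ^ 2)) := by
    filter_upwards [eventually_gt_atTop 0] with s hs
    have hs0 : (s : ℂ) ≠ 0 := by exact_mod_cast hs.ne'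
    have h1 := (tsum_theta_eq_sum hm hs).symm.trans (tsum_theta_eq_transform hm hs)
    have h2 : (1 + I / m * (1 / s) : ℂ) ≠ 0 := by
      intro h
      have h3 := congrArg re h
      have h4 : (1 + I / m * (1 / s) : ℂ) = 1 + ((1 / m * (1 / s) : ℝ) : ℂ) * I := by
        push_cast; ring
      rw [h4] at h3
      simp at h3
    have h3 : (1 / (1 + I / m * (1 / s)) : ℂ) ^ (1 / 2 : ℂ) =
        (s : ℂ) ^ (1 / 2 : ℂ) * (1 / (s + I / m)) ^ (1 / 2 : ℂ) := by
      have h5 : (s : ℂ) + I / m = s * (1 + I / m * (1 / s)) := by field_simp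
      rw [← ofReal_mul_cpow hs]
      · congr 1
        rw [h5]
        field_simp
      · rw [h5]
        exact one_div_ne_zero (mul_ne_zero hs0 h2)
    have h6 : (s : ℂ) ^ (1 / 2 : ℂ) ≠ 0 := by
      rw [cpow_ne_zero_iff_of_exponent_ne_zero (by norm_num)]
      exact hs0
    refine mul_left_cancel₀ h6 ?_
    rw [h1, h3]
    have h7 : 1 / (m : ℂ) ^ 2 * (1 / s) = 1 / ((m : ℂ) ^ 2 * s) := by field_simp
    rw [h7, mul_left_comm]
    congr 1
    rw [← mul_assoc]
    congr 1
    field_simp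
  have := tendsto_nhds_unique hL (hR.congr' hEq)
  rw [this]
  simp [neg_div]

/-- The eighth root of unity comes from the principal branch: log(-i) = -πi/2, so the reciprocal
square root of -i is e^(πi/4). -/
theorem one_div_neg_I_div_cpow :
    1 / (-I / m : ℂ) ^ (1 / 2 : ℂ) =
      (Real.sqrt m : ℝ) * (AddCircle.toCircle ((1 / 8 : ℝ) : UnitAddCircle) : ℂ) := by
  have hm0 : (m : ℂ) ≠ 0 := NeZero.ne _
  have hmR : 0 < (m : ℝ) := by exact_mod_cast Nat.pos_of_ne_zero (NeZero.ne m)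
  have h1 : (-I / m : ℂ) = ((m : ℝ)⁻¹ : ℝ) * -I := by push_cast; field_simp
  have h2 : (-I : ℂ) ≠ 0 := neg_ne_zero.mpr I_ne_zero
  rw [h1, cpow_def_of_ne_zero (by rw [← h1]; exact div_ne_zero h2 hm0),
    log_ofReal_mul (inv_pos.mpr hmR) h2, log_neg_I, AddCircle.toCircle_apply_mk, Circle.coe_exp,
    one_div, ← exp_neg, ← Real.exp_log (Real.sqrt_pos.mpr hmR), ofReal_exp, ← exp_add,
    Real.log_inv, Real.log_sqrt hmR.le]
  congr 1
  push_cast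
  ring

theorem gauss_uForm (hm : Even m) :
    gauss (uForm m hm) =
      (Real.sqrt m : ℝ) * (AddCircle.toCircle ((1 / 8 : ℝ) : UnitAddCircle) : ℂ) := by
  rw [← one_div_neg_I_div_cpow, ← sum_exp_sq hm, gauss_eq]
  have hm0 : (m : ℂ) ≠ 0 := NeZero.ne _
  have hbij : Function.Bijective fun r : Fin m => (((r : ℕ) : ℤ) : ZMod m) := by
    rw [Fintype.bijective_iff_injective_and_card, ZMod.card, Fintype.card_fin]
    refine ⟨fun a b h => ?_, rfl⟩
    have h1 := congrArg ZMod.val h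
    simp only [Int.cast_natCast, ZMod.val_cast_of_lt a.2, ZMod.val_cast_of_lt b.2] at h1
    exact Fin.ext h1
  rw [← Equiv.sum_comp (Equiv.ofBijective _ hbij)]
  refine Finset.sum_congr rfl fun r _ => ?_
  rw [Equiv.ofBijective_apply]
  rw [uForm_intCast, AddCircle.toCircle_apply_mk, Circle.coe_exp]
  congr 1
  push_cast
  field_simp

end Analytic

/-! ### Brown's formula -/

section Brown

theorem gauss_comp_surjective {A C : Type*} [AddCommGroup A] [AddCommGroup C] [Finite A] [Finite C]
    (g : A →+ C) (hg : Function.Surjective g) (ψ : C → UnitAddCircle) :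
    gauss (fun a => ψ (g a)) = (Nat.card g.ker : ℂ) * gauss ψ := by
  classical
  cases nonempty_fintype A
  cases nonempty_fintype C
  rw [gauss_eq, gauss_eq, ← Finset.sum_fiberwise (s := Finset.univ) (g := g), Finset.mul_sum]
  refine Finset.sum_congr rfl fun c _ => ?_
  rw [Finset.sum_congr rfl (g := fun _ => (AddCircle.toCircle (ψ c) : ℂ)), Finset.sum_const,
    nsmul_eq_mul]
  · congr 2
    rw [AddMonoidHom.card_fiber_eq_of_mem_range g (hg c) (hg 0), Nat.card_eq_fintype_card,
      Fintype.card_subtype]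
    simp only [AddMonoidHom.mem_ker]
  · intro a ha
    rw [(Finset.mem_filter.mp ha).2]

variable {V : Type*} [AddCommGroup V] {ι : Type*} [Fintype ι]

theorem even_two_mul_natAbs (d : ℤ) : Even (2 * d.natAbs) := even_two_mul _

/-- The discriminant form of a diagonal lattice with Gram matrix `diag (2 * d i)`. -/
noncomputable def discForm (d : ι → ℤ) [∀ i, NeZero (2 * (d i).natAbs)] :
    QuadraticMap ℤ (∀ i, ZMod (2 * (d i).natAbs)) UnitAddCircle :=
  ∑ i, (d i).sign • (uForm (2 * (d i).natAbs) (even_two_mul_natAbs (d i))).comp (LinearMap.proj i)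

variable (d : ι → ℤ) [∀ i, NeZero (2 * (d i).natAbs)]

theorem discForm_apply (a : ∀ i, ZMod (2 * (d i).natAbs)) :
    discForm d a =
      ∑ i, (d i).sign • uForm (2 * (d i).natAbs) (even_two_mul_natAbs (d i)) (a i) := by
  simp only [discForm, sum_apply, _root_.smul_apply, QuadraticMap.comp_apply, LinearMap.proj_apply]

theorem coe_sum_unitAddCircle (f : ι → ℝ) :
    ((∑ i, f i : ℝ) : UnitAddCircle) = ∑ i, (f i : UnitAddCircle) :=
  map_sum (QuotientAddGroup.mk' (AddSubgroup.zmultiples (1 : ℝ))) f Finset.univ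

theorem discForm_intCast (hd : ∀ i, d i ≠ 0) (α : ι → ℤ) :
    discForm d (fun i => (α i : ZMod (2 * (d i).natAbs))) =
      ((∑ i, (α i : ℝ) ^ 2 / (4 * d i) : ℝ) : UnitAddCircle) := by
  rw [discForm_apply, coe_sum_unitAddCircle]
  refine Finset.sum_congr rfl fun i _ => ?_
  rw [uForm_intCast, ← AddCircle.coe_zsmul]
  congr 1
  rw [zsmul_eq_mul]
  push_cast
  rcases lt_or_gt_of_ne (hd i) with h | h
  · have h1 : ((d i : ℤ) : ℝ) < 0 := by exact_mod_cast h
    rw [Int.sign_eq_neg_one_of_neg h, Nat.cast_natAbs, Int.cast_abs, abs_of_neg h1]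
    push_cast
    field_simp
    norm_num
  · have h1 : 0 < ((d i : ℤ) : ℝ) := by exact_mod_cast h
    rw [Int.sign_eq_one_of_pos h, Nat.cast_natAbs, Int.cast_abs, abs_of_pos h1]
    push_cast
    field_simp
    norm_num

theorem gauss_sign_smul_uForm {m : ℕ} [NeZero m] (hm : Even m) {s : ℤ} (hs : s = 1 ∨ s = -1) :
    gauss (fun a => s • uForm m hm a) =
      (Real.sqrt m : ℝ) * (AddCircle.toCircle ((s / 8 : ℝ) : UnitAddCircle) : ℂ) := by
  rcases hs with rfl | rfl
  · simpa using gauss_uForm hm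
  · have h1 : ((((-1 : ℤ) : ℝ) / 8 : ℝ) : UnitAddCircle) = -((1 / 8 : ℝ) : UnitAddCircle) := by
      rw [← AddCircle.coe_neg]
      congr 1
      norm_num
    simp only [neg_smul, one_smul]
    rw [gauss_neg, gauss_uForm, h1, AddCircle.toCircle_neg, Circle.coe_inv_eq_conj, map_mul,
      Complex.conj_ofReal]

theorem gauss_discForm (hd : ∀ i, d i ≠ 0) :
    ∃ r : ℝ, 0 < r ∧ gauss (discForm d) =
      r * (AddCircle.toCircle (((∑ i, (d i).sign : ℤ) / 8 : ℝ) : UnitAddCircle) : ℂ) := by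
  refine ⟨∏ i, Real.sqrt (2 * (d i).natAbs : ℕ), Finset.prod_pos fun i _ => ?_, ?_⟩
  · refine Real.sqrt_pos.mpr ?_
    exact_mod_cast Nat.pos_of_ne_zero (NeZero.ne (2 * (d i).natAbs))
  · have h1 : (⇑(discForm d) : _ → UnitAddCircle) = fun a => ∑ i,
        (d i).sign • uForm (2 * (d i).natAbs) (even_two_mul_natAbs (d i)) (a i) :=
      funext (discForm_apply d)
    rw [h1, gauss_pi (fun i (a : ZMod (2 * (d i).natAbs)) =>
      (d i).sign • uForm (2 * (d i).natAbs) (even_two_mul_natAbs (d i)) a)]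
    have h2 : ∀ i, (d i).sign = 1 ∨ (d i).sign = -1 := by
      intro i
      rcases lt_or_gt_of_ne (hd i) with h | h
      · exact Or.inr (Int.sign_eq_neg_one_of_neg h)
      · exact Or.inl (Int.sign_eq_one_of_pos h)
    simp only [gauss_sign_smul_uForm _ (h2 _)]
    rw [Finset.prod_mul_distrib, ← toCircle_sum, ← coe_sum_unitAddCircle, Complex.ofReal_prod]
    congr 4
    push_cast
    rw [Finset.sum_div]

theorem coe_intCast_unitAddCircle (k : ℤ) : ((k : ℝ) : UnitAddCircle) = 0 :=
  (AddCircle.coe_eq_zero_iff (1 : ℝ)).mpr ⟨k, by simp⟩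

/-- **Brown's theorem**, with the van der Blij invariant expressed through a Gauss sum. -/
theorem gauss_reductionForm [Module.Free ℤ V] [Module.Finite ℤ V] {B : LinearMap.BilinForm ℤ V}
    (hB : B.IsSymm) (hU : IsUnimodular B) :
    gauss (reductionForm B 2) ≠ 0 ∧ dir (gauss (reductionForm B 2)) =
      (AddCircle.toCircle ((signature B / 8 : ℝ) : UnitAddCircle) : ℂ) := by
  classical
  obtain ⟨n, w, hw, -⟩ := exists_frame_not_dvd (Or.inl rfl) (by simp) hB (hU.nondegMod 0)
  set d : Fin n → ℤ := fun i => B (w i) (w i) with hd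
  have hd0 : ∀ i, d i ≠ 0 := hw.ne
  have hne : ∀ i, NeZero (2 * (d i).natAbs) := fun i =>
    ⟨mul_ne_zero two_ne_zero (Int.natAbs_ne_zero.mpr (hd0 i))⟩
  -- By Parseval for the frame, this map pulls the discriminant form back to B(x, x)/4.
  let h : V →+ ∀ i, ZMod (2 * (d i).natAbs) :=
    AddMonoidHom.mk' (fun x i => ((B (w i) x : ℤ) : ZMod (2 * (d i).natAbs))) fun x y => by
      ext i
      simp
  have hh : ∀ x, h x = fun i => ((B (w i) x : ℤ) : ZMod (2 * (d i).natAbs)) := fun x => rfl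
  have hφ : ∀ x, discForm d (h x) = ((B x x / 4 : ℝ) : UnitAddCircle) := by
    intro x
    rw [hh, discForm_intCast d hd0]
    congr 1
    have h1 : (B x x : ℝ) = ∑ i, (B (w i) x : ℝ) * B (w i) x / B (w i) (w i) := by
      exact_mod_cast congrArg (fun q : ℚ => (q : ℝ)) (hw.parseval x x)
    rw [h1, Finset.sum_div]
    refine Finset.sum_congr rfl fun i _ => ?_
    rw [div_div, mul_comm (4 : ℝ), sq]
  -- On H = 2h(V) the discriminant form takes the values B(y, y) = 0 in ℝ/ℤ, so the Gauss sum can be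
  -- restricted to the orthogonal of H.
  let H : AddSubgroup (∀ i, ZMod (2 * (d i).natAbs)) := h.range.map (zsmulAddGroupHom 2)
  have hH : ∀ a, a ∈ H ↔ ∃ y, h (2 • y) = a := by
    intro a
    constructor
    · rintro ⟨-, ⟨y, rfl⟩, rfl⟩
      exact ⟨y, by simp [zsmulAddGroupHom]⟩
    · rintro ⟨y, rfl⟩
      exact ⟨h y, ⟨y, rfl⟩, by simp [zsmulAddGroupHom]⟩
  have hφ2 : ∀ y, discForm d (h (2 • y)) = 0 := by
    intro y
    rw [hφ, ← coe_intCast_unitAddCircle (B y y)]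
    congr 1
    simp
    ring
  have horth : ∀ a, (∀ b ∈ H, QuadraticMap.polar (discForm d) a b = 0) ↔ a ∈ h.range := by
    intro a
    constructor
    · intro ha
      choose α hα using fun i => ZMod.intCast_surjective (a i)
      have ha' : a = fun i => (α i : ZMod (2 * (d i).natAbs)) := funext fun i => (hα i).symm
      -- Orthogonality of a to h(2y) says that this sum plus B(y, y) is an integer. The resulting
      -- integral functional of y is represented by some x, and evaluating it at w_i shows B(w_i, x)
      -- = α_i, that is, a = h(x).
      have h1 : ∀ y, ∃ k : ℤ, (∑ i, (α i : ℝ) * B (w i) y / d i) = k := by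
        intro y
        have h2 := ha _ ((hH _).mpr ⟨y, rfl⟩)
        have h3 : a + h (2 • y) =
            fun i => ((α i + 2 * B (w i) y : ℤ) : ZMod (2 * (d i).natAbs)) := by
          ext i
          rw [Pi.add_apply, ha', hh]
          simp
        rw [QuadraticMap.polar, hφ2, sub_zero, h3, ha', discForm_intCast d hd0,
          discForm_intCast d hd0, ← AddCircle.coe_sub, ← Finset.sum_sub_distrib,
          AddCircle.coe_eq_zero_iff] at h2
        obtain ⟨k, hk⟩ := h2
        refine ⟨k - B y y, ?_⟩
        have h4 : (B y y : ℝ) = ∑ i, (B (w i) y : ℝ) * B (w i) y / d i := by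
          exact_mod_cast congrArg (fun q : ℚ => (q : ℝ)) (hw.parseval y y)
        have h5 : (k : ℝ) = ∑ i, (α i : ℝ) * B (w i) y / d i +
            ∑ i, (B (w i) y : ℝ) * B (w i) y / d i := by
          rw [← Finset.sum_add_distrib, ← mul_one (k : ℝ), ← zsmul_eq_mul, hk]
          refine Finset.sum_congr rfl fun i _ => ?_
          have : (d i : ℝ) ≠ 0 := by exact_mod_cast hd0 i
          push_cast
          field_simp
          ring
        push_cast
        rw [h4, h5]
        ring
      choose k hk using h1
      obtain ⟨x, hx⟩ := hU.2
        { toFun := k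
          map_add' := fun y z => by
            have : (k (y + z) : ℝ) = k y + k z := by
              rw [← hk, ← hk, ← hk, ← Finset.sum_add_distrib]
              refine Finset.sum_congr rfl fun i _ => ?_
              rw [map_add]
              push_cast
              ring
            exact_mod_cast this
          map_smul' := fun c y => by
            have : (k (c • y) : ℝ) = c * k y := by
              rw [← hk, ← hk, Finset.mul_sum]
              refine Finset.sum_congr rfl fun i _ => ?_
              rw [map_smul, smul_eq_mul]
              push_cast
              ring
            exact_mod_cast this }
      refine ⟨x, ?_⟩
      rw [hh, ha']
      ext i
      congr 1
      rw [← hB.eq, hx]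
      change k (w i) = α i
      have h5 := hk (w i)
      rw [Finset.sum_eq_single i] at h5
      · have : (d i : ℝ) ≠ 0 := by exact_mod_cast hd0 i
        change (α i : ℝ) * (d i : ℝ) / d i = k (w i) at h5
        field_simp at h5
        exact_mod_cast h5.symm
      · intro j _ hj
        simp [hw.orth j i hj]
      · simp
    · rintro ⟨x, rfl⟩ b hb
      obtain ⟨y, rfl⟩ := (hH b).mp hb
      rw [QuadraticMap.polar, hφ2, sub_zero, ← map_add, hφ, hφ, ← AddCircle.coe_sub]
      rw [← coe_intCast_unitAddCircle (B x y + B y y)]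
      congr 1
      have h1 : B (x + 2 • y) (x + 2 • y) = B x x + 4 * B x y + 4 * B y y := by
        simp only [map_add, map_nsmul, LinearMap.add_apply, LinearMap.smul_apply]
        rw [← hB.eq y x]
        simp
        ring
      rw [h1]
      push_cast
      ring
  -- If every B(w_i, x) lies in 2d_iℤ, Parseval makes B(x, y) even for all y, so x lies in 2V. Hence
  -- reduction modulo 2 factors through h(V).
  have hker : ∀ x, h x = 0 → x ⊗ₜ[ℤ] (1 : ZMod 2) = 0 := by
    intro x hx
    obtain ⟨z, rfl⟩ := hU.nondegMod 2 x (by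
      intro y
      have h1 : ∀ i, ∃ c : ℤ, B (w i) x = 2 * d i * c := by
        intro i
        have h2 := congrFun hx i
        rw [hh, Pi.zero_apply, ZMod.intCast_zmod_eq_zero_iff_dvd] at h2
        push_cast at h2
        have h3 : 2 * d i ∣ B (w i) x := by
          rw [← abs_dvd, abs_mul, Int.abs_eq_natAbs (d i)]
          simpa using h2
        exact h3
      choose c hc using h1
      refine ⟨∑ i, c i * B (w i) y, ?_⟩
      have h4 := hw.parseval x y
      have h5 : (B x y : ℚ) = 2 * ∑ i, c i * B (w i) y := by
        push_cast
        rw [h4, Finset.mul_sum]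
        refine Finset.sum_congr rfl fun i _ => ?_
        have : (B (w i) (w i) : ℚ) ≠ 0 := by exact_mod_cast hw.ne i
        rw [hc]
        push_cast
        field_simp
        simp only [hd]
        ring
      exact_mod_cast h5)
    rw [TensorProduct.smul_tmul]
    have : (2 : ℤ) • (1 : ZMod 2) = 0 := by decide
    rw [this, TensorProduct.tmul_zero]
  let π : V →+ V ⊗[ℤ] ZMod 2 := AddMonoidHom.mk' (fun v => v ⊗ₜ[ℤ] (1 : ZMod 2)) fun x y =>
    TensorProduct.add_tmul x y 1
  let g : h.range →+ V ⊗[ℤ] ZMod 2 :=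
    (QuotientAddGroup.lift h.ker π fun x hx => hker x hx).comp
      (QuotientAddGroup.quotientKerEquivRange h).symm.toAddMonoidHom
  have hg : ∀ x, g ⟨h x, x, rfl⟩ = x ⊗ₜ[ℤ] (1 : ZMod 2) := by
    intro x
    have h1 : (QuotientAddGroup.quotientKerEquivRange h).symm ⟨h x, x, rfl⟩ =
        (x : V ⧸ h.ker) := by
      rw [AddEquiv.symm_apply_eq]
      rfl
    change QuotientAddGroup.lift h.ker π (fun x hx => hker x hx)
      ((QuotientAddGroup.quotientKerEquivRange h).symm _) = _
    rw [h1]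
    rfl
  have hgs : Function.Surjective g := by
    intro z
    obtain ⟨x, rfl⟩ := tmul_one_surjective V 2 z
    exact ⟨_, hg x⟩
  have : Fintype h.range := Fintype.ofFinite _
  -- The positive factor |ker g| does not affect the direction, so both sums have the phase σ(B)/8
  -- of the diagonal form.
  have hsum : gauss (discForm d) = (Nat.card g.ker : ℂ) * gauss (reductionForm B 2) := by
    rw [gauss_eq_sum_orthogonal (discForm d) H (fun b hb => by
      obtain ⟨y, rfl⟩ := (hH b).mp hb
      exact hφ2 y), ← gauss_comp_surjective g hgs, gauss_eq]
    simp only [horth]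
    rw [Finset.sum_subtype (F := this) _ (p := fun a => a ∈ h.range) (by simp)]
    refine Finset.sum_congr (by ext; simp) fun a _ => ?_
    obtain ⟨-, x, rfl⟩ := a
    rw [hg, reductionForm_tmul_one B hB 2 even_two, hφ]
    norm_num
  obtain ⟨r, hr, hG⟩ := gauss_discForm d hd0
  rw [hsum, ← hw.signature_eq] at hG
  have hc : (0 : ℝ) < Nat.card g.ker := by exact_mod_cast Nat.card_pos
  constructor
  · intro h0
    rw [h0, mul_zero] at hG
    exact mul_ne_zero (by exact_mod_cast hr.ne') (Circle.coe_ne_zero _) hG.symm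
  · rw [← dir_ofReal_mul hc, Complex.ofReal_natCast, hG, dir_ofReal_mul hr, dir_toCircle]

end Brown

/-! ### Relations between Gauss sums from two frames of a diagonal form -/

section DiagForm

variable {ι : Type*} [Fintype ι]

/-- The diagonal form with coefficients `d` on `ℤ^ι`. -/
noncomputable def diagForm (d : ι → ℤ) : LinearMap.BilinForm ℤ (ι → ℤ) :=
  LinearMap.mk₂ ℤ (fun x y => ∑ i, d i * (x i * y i))
    (fun x x' y => by simp only [Pi.add_apply, ← Finset.sum_add_distrib]; congr! 1; ring)
    (fun c x y => by simp only [Pi.smul_apply, smul_eq_mul, Finset.mul_sum]; congr! 1; ring)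
    (fun x y y' => by simp only [Pi.add_apply, ← Finset.sum_add_distrib]; congr! 1; ring)
    (fun c x y => by simp only [Pi.smul_apply, smul_eq_mul, Finset.mul_sum]; congr! 1; ring)

theorem diagForm_apply (d : ι → ℤ) (x y : ι → ℤ) :
    diagForm d x y = ∑ i, d i * (x i * y i) := rfl

theorem isSymm_diagForm (d : ι → ℤ) : (diagForm d).IsSymm :=
  ⟨fun x y => by
    simp only [diagForm_apply]
    exact Finset.sum_congr rfl fun i _ => by ring⟩

variable [DecidableEq ι]

theorem diagForm_single (d : ι → ℤ) (i : ι) (y : ι → ℤ) :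
    diagForm d (Pi.single i 1) y = d i * y i := by
  rw [diagForm_apply, Finset.sum_eq_single i]
  · simp
  · intro j _ hj
    simp [hj]
  · simp

theorem isFrame_single {d : ι → ℤ} (hd : ∀ i, d i ≠ 0) :
    IsFrame (diagForm d) (fun i => Pi.single i (1 : ℤ)) where
  orth i j hij := by simp [diagForm_single, hij]
  ne i := by simpa [diagForm_single] using hd i
  complete x hx := by
    ext i
    simpa [diagForm_single, hd i] using hx i

variable {T : Type*} [AddCommGroup T] [Finite T] {N : ℤ}

/-- Both products compute the Gauss sum of one and the same tensor product, from the standard frame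
and from w. -/
theorem IsFrame.prod_gauss_eq {d : ι → ℤ} (hd : ∀ i, IsCoprime (d i) N) (hd0 : ∀ i, d i ≠ 0)
    {w : ι → ι → ℤ} (hw : IsFrame (diagForm d) w)
    (hwN : ∀ i, IsCoprime (diagForm d (w i) (w i)) N) (hN : ∀ t : T, N • t = 0)
    (ψ : QuadraticMap ℤ T UnitAddCircle) :
    ∏ i, gauss (fun t => d i • ψ t) = ∏ i, gauss (fun t => diagForm d (w i) (w i) • ψ t) := by
  obtain ⟨Q, hQ⟩ := exists_isTensor (diagForm d) (isSymm_diagForm d) ψ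
  have h1 := (isFrame_single hd0).gauss_isTensor hN
    (IsCoprime.prod_left fun i _ => by simpa [diagForm_single] using hd i) hQ
  have h2 := hw.gauss_isTensor hN (IsCoprime.prod_left fun i _ => hwN i) hQ
  rw [← h2, h1]
  simp [diagForm_single]

end DiagForm

/-! ### Dependence of G(dψ) on d -/

section RankOne

variable {T : Type*} [AddCommGroup T] [Finite T] {N : ℤ}

theorem gauss_mul_sq (hN : ∀ t : T, N • t = 0) (ψ : QuadraticMap ℤ T UnitAddCircle) (d : ℤ)
    {k : ℤ} (hk : IsCoprime k N) :
    gauss (fun t => (d * k ^ 2) • ψ t) = gauss (fun t => d • ψ t) := by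
  have hbij : Function.Bijective fun t : T => k • t := by
    refine ⟨fun s t hst => ?_, fun t => exists_zsmul_of_isCoprime hk (hN t)⟩
    rw [← sub_eq_zero]
    refine eq_zero_of_zsmul_of_isCoprime hk ?_ (hN _)
    rw [smul_sub, sub_eq_zero]
    exact hst
  rw [← gauss_comp_equiv (Equiv.ofBijective _ hbij) fun t => d • ψ t]
  congr 1
  ext t
  rw [Equiv.ofBijective_apply, QuadraticMap.map_smul, ← mul_smul, sq]

/-- N²ψ(t) = ψ(Nt) = 0. -/
theorem gauss_congr_mod (hN : ∀ t : T, N • t = 0) (ψ : QuadraticMap ℤ T UnitAddCircle) {a b : ℤ}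
    (hab : N ^ 2 ∣ a - b) : gauss (fun t => a • ψ t) = gauss (fun t => b • ψ t) := by
  congr 1
  ext t
  obtain ⟨c, hc⟩ := hab
  rw [← sub_eq_zero, ← sub_smul, hc, mul_comm, mul_smul, sq, ← QuadraticMap.map_smul, hN,
    QuadraticMap.map_zero, smul_zero]

/-- In the form ⟨d₁, d₂⟩ the vector (x, y) has norm e, and (-d₂y, d₁x) is orthogonal to it with norm
d₁d₂e. -/
theorem gauss_mul_gauss (hN : ∀ t : T, N • t = 0) (ψ : QuadraticMap ℤ T UnitAddCircle)
    {d₁ d₂ x y e : ℤ} (h₁ : IsCoprime d₁ N) (h₂ : IsCoprime d₂ N) (he : IsCoprime e N)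
    (h₁0 : d₁ ≠ 0) (h₂0 : d₂ ≠ 0) (he0 : e ≠ 0) (hxy : d₁ * x ^ 2 + d₂ * y ^ 2 = e) :
    gauss (fun t => d₁ • ψ t) * gauss (fun t => d₂ • ψ t) =
      gauss (fun t => e • ψ t) * gauss (fun t => (d₁ * d₂ * e) • ψ t) := by
  have e1 : diagForm ![d₁, d₂] ![x, y] ![x, y] = e := by
    simp [diagForm_apply]
    linear_combination hxy
  have e2 : diagForm ![d₁, d₂] ![-(d₂ * y), d₁ * x] ![-(d₂ * y), d₁ * x] = d₁ * d₂ * e := by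
    simp [diagForm_apply]
    linear_combination d₁ * d₂ * hxy
  have hw : IsFrame (diagForm ![d₁, d₂]) ![![x, y], ![-(d₂ * y), d₁ * x]] := by
    refine ⟨?_, ?_, ?_⟩
    · intro i j hij
      fin_cases i <;> fin_cases j <;> simp [diagForm_apply] at hij ⊢ <;> ring
    · intro i
      fin_cases i
      · simpa [e1] using he0
      · simpa [e2] using ⟨⟨h₁0, h₂0⟩, he0⟩
    · intro c hc
      have c1 := hc 0
      have c2 := hc 1
      simp [diagForm_apply] at c1 c2
      have c3 : -(y * c 0) + x * c 1 = 0 := by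
        refine (mul_eq_zero.mp (?_ : (d₁ * d₂) * (-(y * c 0) + x * c 1) = 0)).resolve_left
          (mul_ne_zero h₁0 h₂0)
        linear_combination c2
      ext i
      fin_cases i
      · refine (mul_eq_zero.mp (?_ : e * c 0 = 0)).resolve_left he0
        linear_combination x * c1 - d₂ * y * c3 - c 0 * hxy
      · refine (mul_eq_zero.mp (?_ : e * c 1 = 0)).resolve_left he0
        linear_combination y * c1 + d₁ * x * c3 - c 1 * hxy
  have := hw.prod_gauss_eq (N := N) (fun i => by fin_cases i <;> simpa)
    (fun i => by fin_cases i <;> simpa) (fun i => by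
      fin_cases i
      · simpa [e1] using he
      · simpa [e2] using (h₁.mul_left h₂).mul_left he) hN ψ
  simpa [Fin.prod_univ_two, e1, e2] using this

theorem gauss_neg_smul (ψ : QuadraticMap ℤ T UnitAddCircle) (d : ℤ) :
    gauss (fun t => (-d) • ψ t) = conj (gauss fun t => d • ψ t) := by
  rw [← gauss_neg]
  simp only [neg_smul]

/-- Since 7 = 2² + 1 + 1 + 1, the form ⟨1, 1, 1, 1⟩ has a frame of four vectors of norm 7. As 7 ≡ -1
modulo 8, this is what forces u⁸ = 1 on 2-groups. -/
theorem gauss_pow_four (hN : ∀ t : T, N • t = 0) (ψ : QuadraticMap ℤ T UnitAddCircle)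
    (h7 : IsCoprime 7 N) : gauss (fun t => (1 : ℤ) • ψ t) ^ 4 =
      gauss (fun t => (7 : ℤ) • ψ t) ^ 4 := by
  let w : Fin 4 → Fin 4 → ℤ :=
    ![![2, 1, 1, 1], ![-1, 2, -1, 1], ![-1, 1, 2, -1], ![-1, -1, 1, 2]]
  have e1 : ∀ i, diagForm (fun _ => 1) (w i) (w i) = 7 := by
    intro i
    rw [diagForm_apply]
    fin_cases i <;> decide
  have hw : IsFrame (diagForm fun _ => 1) w := by
    refine ⟨?_, fun i => by rw [e1]; norm_num, ?_⟩
    · intro i j hij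
      rw [diagForm_apply]
      fin_cases i <;> fin_cases j <;> first | exact absurd rfl hij | decide
    · intro c hc
      have c0 := hc 0
      have c1 := hc 1
      have c2 := hc 2
      have c3 := hc 3
      simp [diagForm_apply, Fin.sum_univ_four, w] at c0 c1 c2 c3
      ext i
      fin_cases i <;> simp <;> omega
  have := hw.prod_gauss_eq (N := N) (fun i => isCoprime_one_left) (fun i => one_ne_zero)
    (fun i => by rwa [e1]) hN ψ
  simpa only [e1, Finset.prod_const, Finset.card_univ, Fintype.card_fin] using this

end RankOne

/-! ### Odd primes: multiplicativity of d ↦ G(dψ) -/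

section OddPrime

variable {T : Type*} [AddCommGroup T] [Finite T] {p : ℕ} [Fact p.Prime] {k : ℕ}

theorem exists_add_sq_eq_one (hp : p ≠ 2) {a b : ℤ} (ha : ¬ (p : ℤ) ∣ a) (hb : ¬ (p : ℤ) ∣ b) :
    ∃ x y : ℤ, (p : ℤ) ∣ a * x ^ 2 + b * y ^ 2 - 1 := by
  have ha' : (a : ZMod p) ≠ 0 := by rwa [Ne, ZMod.intCast_zmod_eq_zero_iff_dvd]
  have hb' : (b : ZMod p) ≠ 0 := by rwa [Ne, ZMod.intCast_zmod_eq_zero_iff_dvd]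
  obtain ⟨x, y, hxy⟩ := FiniteField.exists_root_sum_quadratic
    (f := Polynomial.C (a : ZMod p) * Polynomial.X ^ 2)
    (g := Polynomial.C (b : ZMod p) * Polynomial.X ^ 2 - Polynomial.C 1)
    (Polynomial.degree_C_mul_X_pow 2 ha') (by
      rw [Polynomial.degree_sub_C]
      · exact Polynomial.degree_C_mul_X_pow 2 hb'
      · rw [Polynomial.degree_C_mul_X_pow 2 hb']
        norm_num) (by
      rw [ZMod.card]
      exact Nat.odd_iff.mp ((Fact.out : p.Prime).odd_of_ne_two hp))
  obtain ⟨x, rfl⟩ := ZMod.intCast_surjective x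
  obtain ⟨y, rfl⟩ := ZMod.intCast_surjective y
  refine ⟨x, y, ?_⟩
  rw [← ZMod.intCast_zmod_eq_zero_iff_dvd]
  push_cast
  simp at hxy
  linear_combination hxy

theorem isCoprime_prime_pow {a : ℤ} (ha : ¬ (p : ℤ) ∣ a) : IsCoprime a ((p : ℤ) ^ k) :=
  (((Nat.prime_iff_prime_int.mp Fact.out).coprime_iff_not_dvd.mpr ha).symm).pow_right

/-- An integer e ≡ 1 modulo p is a square modulo p^(2k): e to the power p^(2k) is 1 there, so e is
congruent to (e^c)² with 2c = p^(2k) + 1. -/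
theorem gauss_mul_of_dvd_sub_one (hp : p ≠ 2) (hT : ∀ t : T, ((p : ℤ) ^ k) • t = 0)
    (ψ : QuadraticMap ℤ T UnitAddCircle) (d : ℤ) {e : ℤ} (he : (p : ℤ) ∣ e - 1) :
    gauss (fun t => (d * e) • ψ t) = gauss (fun t => d • ψ t) := by
  have hp' : p.Prime := Fact.out
  have hep : ¬ (p : ℤ) ∣ e := fun h =>
    (Nat.prime_iff_prime_int.mp hp').not_isUnit
      (isUnit_of_dvd_one (by simpa using dvd_sub h he))
  obtain ⟨c, hc⟩ : Even (p ^ (2 * k) + 1) :=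
    ((hp'.odd_of_ne_two hp).pow).add_one
  rw [← gauss_mul_sq hT ψ d (k := e ^ c) (isCoprime_prime_pow hep).pow_left]
  refine gauss_congr_mod hT ψ ?_
  have h1 := dvd_sub_pow_of_dvd_sub (R := ℤ) (p := p) (a := e) (b := 1) he (2 * k)
  rw [one_pow] at h1
  have h2 : (e ^ c) ^ 2 = e * e ^ p ^ (2 * k) := by
    rw [← pow_mul, mul_two, ← hc, pow_succ, mul_comm]
  rw [h2, ← mul_sub, ← pow_mul, mul_comm k 2]
  have h3 : e - e * e ^ p ^ (2 * k) = -e * (e ^ p ^ (2 * k) - 1) := by ring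
  rw [h3]
  exact ((pow_dvd_pow _ (Nat.le_succ _)).trans h1).mul_left _ |>.mul_left _

/-- The form ⟨a, b⟩ represents some e ≡ 1 modulo p, and such an e may be replaced by 1 in both
resulting sums. -/
theorem gauss_mul_gauss_odd (hp : p ≠ 2) (hT : ∀ t : T, ((p : ℤ) ^ k) • t = 0)
    (ψ : QuadraticMap ℤ T UnitAddCircle) {a b : ℤ} (ha : ¬ (p : ℤ) ∣ a) (hb : ¬ (p : ℤ) ∣ b) :
    gauss (fun t => a • ψ t) * gauss (fun t => b • ψ t) =
      gauss (fun t => (1 : ℤ) • ψ t) * gauss (fun t => (a * b) • ψ t) := by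
  obtain ⟨x, y, hxy⟩ := exists_add_sq_eq_one hp ha hb
  set e := a * x ^ 2 + b * y ^ 2 with he
  have hp' : Prime (p : ℤ) := Nat.prime_iff_prime_int.mp Fact.out
  have hep : ¬ (p : ℤ) ∣ e := fun h =>
    hp'.not_isUnit (isUnit_of_dvd_one (by simpa using dvd_sub h hxy))
  rw [gauss_mul_gauss hT ψ (isCoprime_prime_pow ha) (isCoprime_prime_pow hb)
    (isCoprime_prime_pow hep) (fun h => ha (h ▸ dvd_zero _)) (fun h => hb (h ▸ dvd_zero _))
    (fun h => hep (h ▸ dvd_zero _)) he.symm, gauss_mul_of_dvd_sub_one hp hT ψ _ hxy]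
  have h1 := gauss_mul_of_dvd_sub_one hp hT ψ 1 hxy
  rw [one_mul] at h1
  rw [h1]

theorem gauss_mul_prod_gauss_odd (hp : p ≠ 2) (hT : ∀ t : T, ((p : ℤ) ^ k) • t = 0)
    (ψ : QuadraticMap ℤ T UnitAddCircle) {ι : Type*} (s : Finset ι) (d : ι → ℤ)
    (hd : ∀ i, ¬ (p : ℤ) ∣ d i) :
    gauss (fun t => (1 : ℤ) • ψ t) * ∏ i ∈ s, gauss (fun t => d i • ψ t) =
      gauss (fun t => (1 : ℤ) • ψ t) ^ s.card * gauss (fun t => (∏ i ∈ s, d i) • ψ t) := by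
  classical
  induction s using Finset.induction_on with
  | empty => simp
  | insert a s ha ih =>
    have hp' : Prime (p : ℤ) := Nat.prime_iff_prime_int.mp Fact.out
    have h1 := gauss_mul_gauss_odd hp hT ψ (hd a) (b := ∏ i ∈ s, d i)
      (fun h => by
        obtain ⟨i, -, hi⟩ := (hp'.dvd_finsetProd_iff _).mp h
        exact hd i hi)
    rw [Finset.prod_insert ha, Finset.prod_insert ha, Finset.card_insert_of_notMem ha, pow_succ,
      mul_left_comm, ih, mul_left_comm, h1]
    ring

end OddPrime

/-! ### The phase law for odd p -/

section Law

variable {V : Type*} [AddCommGroup V] [Module.Free ℤ V] [Module.Finite ℤ V]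

/-- The Gauss sum of `B ⊗ ψ` has phase `σ(B) β(ψ)`, and `8 β(ψ) = 0`. -/
structure PhaseLaw (B : LinearMap.BilinForm ℤ V) {T : Type*} [AddCommGroup T] [Finite T]
    (ψ : QuadraticMap ℤ T UnitAddCircle) : Prop where
  pow_eight : dir (gauss ψ) ^ 8 = 1
  tensor : ∀ Q, IsTensor B ψ Q → dir (gauss Q) = dir (gauss ψ) ^ signature B

variable {B : LinearMap.BilinForm ℤ V} {ι : Type*} [Fintype ι] [DecidableEq ι]
  {T : Type*} [AddCommGroup T] [Finite T]

theorem dir_prod {κ : Type*} (s : Finset κ) (f : κ → ℂ) :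
    dir (∏ i ∈ s, f i) = ∏ i ∈ s, dir (f i) := by
  classical
  induction s using Finset.induction_on with
  | empty => simp [dir]
  | insert a s ha ih => rw [Finset.prod_insert ha, Finset.prod_insert ha, dir_mul, ih]

theorem phaseLaw_odd_prime (hB : B.IsSymm) (e : Module.Basis ι ℤ V)
    (hdet : (LinearMap.BilinForm.toMatrix e B).det = 1 ∨
      (LinearMap.BilinForm.toMatrix e B).det = -1) {p : ℕ} [Fact p.Prime] (hp : p ≠ 2) {k : ℕ}
    (hT : ∀ t : T, ((p : ℤ) ^ k) • t = 0) {ψ : QuadraticMap ℤ T UnitAddCircle}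
    (hG : gauss ψ ≠ 0) : PhaseLaw B ψ := by
  have hp' : Prime (p : ℤ) := Nat.prime_iff_prime_int.mp Fact.out
  have hG1 : gauss (fun t => (1 : ℤ) • ψ t) = gauss ψ := by simp only [one_smul]
  set u := dir (gauss ψ) with hu
  have hu0 : u ≠ 0 := dir_ne_zero hG
  have hneg : gauss (fun t => (-1 : ℤ) • ψ t) = conj (gauss ψ) := by
    rw [gauss_neg_smul, hG1]
  have hp1 : ¬ (p : ℤ) ∣ -1 := fun h => hp'.not_isUnit (isUnit_of_dvd_one (by simpa using h))
  have hu4 : u ^ 4 = 1 := by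
    have h1 := gauss_mul_gauss_odd hp hT ψ hp1 hp1
    rw [neg_mul_neg, one_mul, hneg, hG1] at h1
    have h2 := congrArg dir h1
    rw [dir_mul, dir_mul, dir_conj, ← hu, conj_dir hG, ← hu] at h2
    field_simp at h2
    linear_combination -h2
  refine ⟨by rw [show (8 : ℕ) = 4 * 2 from rfl, pow_mul, hu4, one_pow], fun Q hQ => ?_⟩
  have h2p : ¬ (p : ℤ) ∣ 2 := by
    intro h
    exact hp ((Nat.prime_dvd_prime_iff_eq Fact.out Nat.prime_two).mp (by exact_mod_cast h))
  obtain ⟨n, w, hw, hwp⟩ := exists_frame_not_dvd (Or.inr hp') h2p hB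
    ((isUnimodular_of_det e hdet).nondegMod p)
  have hDp : ¬ (p : ℤ) ∣ frameDet B w := fun h => by
    obtain ⟨i, -, hi⟩ := (hp'.dvd_finsetProd_iff _).mp h
    exact hwp i hi
  have h1 := hw.gauss_isTensor hT (isCoprime_prime_pow hDp) hQ
  have h2 := gauss_mul_prod_gauss_odd hp hT ψ Finset.univ (fun i => B (w i) (w i)) hwp
  obtain ⟨hcard, c, hc⟩ := hw.frameDet_eq e
  obtain ⟨j, hσ, hj⟩ := exists_signature_eq hB e hdet
  have hcp : ¬ (p : ℤ) ∣ c := by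
    intro h
    rw [hc] at hDp
    exact hDp ((h.pow two_ne_zero).mul_right _)
  change _ = _ * gauss (fun t => frameDet B w • ψ t) at h2
  rw [← h1, hc, mul_comm (c ^ 2), gauss_mul_sq hT ψ _ (isCoprime_prime_pow hcp), hj, hG1,
    Finset.card_univ, hcard] at h2
  have h3 := congrArg dir h2
  rw [dir_mul, dir_mul, dir_pow, ← hu] at h3
  have hu4z : u ^ (4 : ℤ) = 1 := by exact_mod_cast hu4
  rw [hσ]
  -- Up to a square the product of the norms is (-1)^j. For j even the direction is u^n; for j odd a
  -- conjugate gives u^(n-2). Both equal u^(n-2j), because u⁴ = 1.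
  rcases Nat.even_or_odd j with ⟨l, rfl⟩ | ⟨l, rfl⟩
  · rw [Even.neg_one_pow ⟨l, rfl⟩, hG1, ← hu, mul_comm] at h3
    rw [mul_right_cancel₀ hu0 h3]
    have : (Fintype.card ι : ℤ) - 2 * ((l + l : ℕ) : ℤ) = Fintype.card ι + 4 * (-l) := by
      push_cast; ring
    rw [this, zpow_add₀ hu0, zpow_mul, hu4z, one_zpow, mul_one, zpow_natCast]
  · rw [Odd.neg_one_pow ⟨l, rfl⟩, hneg, dir_conj, ← hu, conj_dir hG, ← hu] at h3
    have : (Fintype.card ι : ℤ) - 2 * ((2 * l + 1 : ℕ) : ℤ) =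
        Fintype.card ι + (-1) + (-1) + 4 * (-l) := by
      push_cast; ring
    rw [this, zpow_add₀ hu0, zpow_add₀ hu0, zpow_add₀ hu0, zpow_mul, hu4z, one_zpow, mul_one,
      zpow_natCast, zpow_neg_one, ← h3]
    field_simp

end Law

/-! ### The prime 2: G(dψ) for odd d -/

section Two

variable {T : Type*} [AddCommGroup T] [Finite T] {k : ℕ}

theorem exists_odd_sq_congr {a b : ℤ} (ha : ¬ 2 ∣ a) (hab : 8 ∣ a - b) (K : ℕ) :
    ∃ c : ℤ, ¬ 2 ∣ c ∧ (2 : ℤ) ^ K ∣ a * c ^ 2 - b := by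
  induction K with
  | zero => exact ⟨1, by decide, by simp⟩
  | succ K ih =>
    by_cases hK : K < 3
    · refine ⟨1, by decide, ?_⟩
      rw [one_pow, mul_one]
      exact (pow_dvd_pow 2 (show K + 1 ≤ 3 by omega)).trans (by simpa using hab)
    · obtain ⟨c, hc, r, hr⟩ := ih
      obtain ⟨L, rfl⟩ : ∃ L, K = L + 3 := ⟨K - 3, by omega⟩
      by_cases h2 : 2 ∣ r
      · obtain ⟨s, rfl⟩ := h2
        exact ⟨c, hc, s, by rw [hr]; ring⟩
      · have h3 : (2 : ℤ) ∣ r + a * c := by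
          rw [← even_iff_two_dvd] at *
          rw [Int.even_add, Int.even_mul]
          tauto
        obtain ⟨s, hs⟩ := h3
        -- Hensel lifting at 2: adding 2^(L+2) to c changes ac² by ac·2^(L+3) modulo 2^(L+4), which
        -- repairs the odd remainder r.
        refine ⟨c + 2 ^ (L + 2), ?_, s + a * 2 ^ L, ?_⟩
        · rw [pow_add]
          omega
        · have h4 : (r : ℤ) = 2 * s - a * c := by linarith
          rw [h4] at hr
          have h5 : a * (c + 2 ^ (L + 2)) ^ 2 - b =
              (a * c ^ 2 - b) + a * (c * 2 ^ (L + 3) + 2 ^ (L + 2) * 2 ^ (L + 2)) := by ring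
          rw [h5, hr]
          ring

theorem isCoprime_two_pow {a : ℤ} (ha : ¬ 2 ∣ a) : IsCoprime a ((2 : ℤ) ^ k) :=
  isCoprime_prime_pow (p := 2) ha

theorem gauss_congr_mod_eight (hT : ∀ t : T, ((2 : ℤ) ^ k) • t = 0)
    (ψ : QuadraticMap ℤ T UnitAddCircle) {a b : ℤ} (ha : ¬ 2 ∣ a) (hab : 8 ∣ a - b) :
    gauss (fun t => a • ψ t) = gauss (fun t => b • ψ t) := by
  obtain ⟨c, hc, h⟩ := exists_odd_sq_congr ha hab (k * 2)
  rw [← gauss_mul_sq hT ψ a (isCoprime_two_pow hc)]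
  refine gauss_congr_mod hT ψ ?_
  rwa [← pow_mul]

/-- The form ⟨1, 1⟩ represents 5 = 1² + 2². So G(5ψ) = ±G(ψ), and this sign is the only ambiguity
left. -/
theorem gauss_sq_eq_gauss_five_sq (hT : ∀ t : T, ((2 : ℤ) ^ k) • t = 0)
    (ψ : QuadraticMap ℤ T UnitAddCircle) :
    gauss (fun t => (1 : ℤ) • ψ t) ^ 2 = gauss (fun t => (5 : ℤ) • ψ t) ^ 2 := by
  have h1 : IsCoprime (1 : ℤ) ((2 : ℤ) ^ k) := isCoprime_one_left
  have h5 : IsCoprime (5 : ℤ) ((2 : ℤ) ^ k) := isCoprime_two_pow (by decide)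
  have := gauss_mul_gauss hT ψ (x := 1) (y := 2) h1 h1 h5 one_ne_zero one_ne_zero (by norm_num)
    (by norm_num)
  simpa [sq] using this

/-- Up to the sign character modulo 8, the direction of `G(dψ)` for odd `d` is determined by `d`
modulo 4. -/
theorem exists_dir_gauss_eq (hT : ∀ t : T, ((2 : ℤ) ^ k) • t = 0)
    {ψ : QuadraticMap ℤ T UnitAddCircle} (hG : gauss ψ ≠ 0) :
    (∀ d : ℤ, ¬ 2 ∣ d →
      dir (gauss fun t => d • ψ t) = dir (gauss ψ) ^ (ZMod.χ₄ d)) ∨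
    (∀ d : ℤ, ¬ 2 ∣ d →
      dir (gauss fun t => d • ψ t) = (ZMod.χ₈ d : ℤ) * dir (gauss ψ) ^ (ZMod.χ₄ d)) := by
  have hG1 : gauss (fun t => (1 : ℤ) • ψ t) = gauss ψ := by simp only [one_smul]
  have h7 : dir (gauss fun t => (7 : ℤ) • ψ t) = (dir (gauss ψ))⁻¹ := by
    rw [gauss_congr_mod_eight hT ψ (b := -1) (by decide) (by decide), gauss_neg_smul, hG1,
      dir_conj, conj_dir hG]
  have h3 : gauss (fun t => (3 : ℤ) • ψ t) = conj (gauss fun t => (5 : ℤ) • ψ t) := by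
    rw [gauss_congr_mod_eight hT ψ (b := -5) (by decide) (by decide), gauss_neg_smul]
  have hmod : ∀ d : ℤ, ¬ 2 ∣ d → ∃ r ∈ ({1, 3, 5, 7} : Set ℤ), 8 ∣ d - r := by
    intro d hd
    have : d % 8 = 1 ∨ d % 8 = 3 ∨ d % 8 = 5 ∨ d % 8 = 7 := by omega
    refine ⟨d % 8, by simpa using this, by omega⟩
  have hχ : ∀ d r : ℤ, 8 ∣ d - r → ZMod.χ₄ (d : ZMod 4) = ZMod.χ₄ (r : ZMod 4) ∧
      ZMod.χ₈ (d : ZMod 8) = ZMod.χ₈ (r : ZMod 8) := by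
    intro d r h
    have e1 : (d : ZMod 8) = r := by
      rw [← sub_eq_zero, ← Int.cast_sub, ZMod.intCast_zmod_eq_zero_iff_dvd]
      exact h
    have e2 : (d : ZMod 4) = r := by
      rw [← sub_eq_zero, ← Int.cast_sub, ZMod.intCast_zmod_eq_zero_iff_dvd]
      exact (by norm_num : ((4 : ℕ) : ℤ) ∣ 8).trans h
    rw [e1, e2]
    exact ⟨rfl, rfl⟩
  have v1 : ZMod.χ₄ ((1 : ℤ) : ZMod 4) = 1 ∧ ZMod.χ₈ ((1 : ℤ) : ZMod 8) = 1 := by decide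
  have v3 : ZMod.χ₄ ((3 : ℤ) : ZMod 4) = -1 ∧ ZMod.χ₈ ((3 : ℤ) : ZMod 8) = -1 := by decide
  have v5 : ZMod.χ₄ ((5 : ℤ) : ZMod 4) = 1 ∧ ZMod.χ₈ ((5 : ℤ) : ZMod 8) = -1 := by decide
  have v7 : ZMod.χ₄ ((7 : ℤ) : ZMod 4) = -1 ∧ ZMod.χ₈ ((7 : ℤ) : ZMod 8) = 1 := by decide
  have hsq := gauss_sq_eq_gauss_five_sq hT ψ
  rw [hG1] at hsq
  rcases sq_eq_sq_iff_eq_or_eq_neg.mp hsq with h5 | h5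
  · left
    intro d hd
    obtain ⟨r, hr, h8⟩ := hmod d hd
    rw [gauss_congr_mod_eight hT ψ hd h8, (hχ d r h8).1]
    rcases hr with rfl | rfl | rfl | rfl
    · rw [hG1, v1.1, zpow_one]
    · rw [h3, ← h5, dir_conj, conj_dir hG, v3.1, zpow_neg_one]
    · rw [← h5, v5.1, zpow_one]
    · rw [h7, v7.1, zpow_neg_one]
  · right
    have h5' : gauss (fun t => (5 : ℤ) • ψ t) = -gauss ψ := by rw [h5, neg_neg]
    have hdn : dir (-gauss ψ) = -dir (gauss ψ) := by rw [dir, dir, norm_neg, neg_div]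
    intro d hd
    obtain ⟨r, hr, h8⟩ := hmod d hd
    rw [gauss_congr_mod_eight hT ψ hd h8, (hχ d r h8).1, (hχ d r h8).2]
    rcases hr with rfl | rfl | rfl | rfl
    · rw [hG1, v1.1, v1.2, zpow_one]
      simp
    · rw [h3, h5', dir_conj, hdn, map_neg, conj_dir hG, v3.1, v3.2, zpow_neg_one]
      simp
    · rw [h5', hdn, v5.1, v5.2, zpow_one]
      simp
    · rw [h7, v7.1, v7.2, zpow_neg_one]
      simp

theorem dir_pow_eight (hT : ∀ t : T, ((2 : ℤ) ^ k) • t = 0)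
    {ψ : QuadraticMap ℤ T UnitAddCircle} (hG : gauss ψ ≠ 0) : dir (gauss ψ) ^ 8 = 1 := by
  have hG1 : gauss (fun t => (1 : ℤ) • ψ t) = gauss ψ := by simp only [one_smul]
  have h := congrArg dir (gauss_pow_four hT ψ (isCoprime_two_pow (by decide)))
  rw [gauss_congr_mod_eight hT ψ (a := 7) (b := -1) (by decide) (by decide),
    gauss_neg_smul, hG1, dir_pow, dir_pow, dir_conj, conj_dir hG] at h
  have hu0 := dir_ne_zero hG
  field_simp at h
  exact h

/-- The product of Gauss sums of odd multiples of `ψ` whose product is `±1` modulo squares. -/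
theorem dir_prod_gauss_odd (hT : ∀ t : T, ((2 : ℤ) ^ k) • t = 0)
    {ψ : QuadraticMap ℤ T UnitAddCircle} (hG : gauss ψ ≠ 0) {κ : Type*} [Fintype κ] {d : κ → ℤ}
    (hd : ∀ i, ¬ 2 ∣ d i) (hχ : ZMod.χ₈ ((∏ i, d i : ℤ) : ZMod 8) = 1) :
    dir (∏ i, gauss fun t => d i • ψ t) = dir (gauss ψ) ^ (∑ i, ZMod.χ₄ (d i)) := by
  have hu0 := dir_ne_zero hG
  have hz : ∀ s : Finset κ, ∏ i ∈ s, dir (gauss ψ) ^ (ZMod.χ₄ (d i)) =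
      dir (gauss ψ) ^ (∑ i ∈ s, ZMod.χ₄ (d i)) := by
    classical
    intro s
    induction s using Finset.induction_on with
    | empty => simp
    | insert a s ha ih => rw [Finset.prod_insert ha, Finset.sum_insert ha, zpow_add₀ hu0, ih]
  rw [dir_prod, ← hz]
  -- In the second case the signs χ₈(d_i) multiply to χ₈(∏ d_i) = 1, so both cases give the same
  -- answer.
  rcases exists_dir_gauss_eq hT hG with h | h
  · exact Finset.prod_congr rfl fun i _ => h _ (hd i)
  · rw [Finset.prod_congr rfl fun i _ => h _ (hd i), Finset.prod_mul_distrib, ← Int.cast_prod,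
      ← map_prod, ← Int.cast_prod, hχ, Int.cast_one, one_mul]

end Two

/-! ### Adding an orthogonal summand ⟨1⟩ -/

section AddOne

/-- The underlying group of the orthogonal sum of `V` and `ℤ`. -/
def PlusInt (V : Type*) : Type _ := V × ℤ

instance (V : Type*) [AddCommGroup V] : AddCommGroup (PlusInt V) :=
  inferInstanceAs (AddCommGroup (V × ℤ))

variable {V : Type*} [AddCommGroup V]

/-- `PlusInt V` is `V × ℤ`. -/
def plusIntEquiv (V : Type*) [AddCommGroup V] : (V × ℤ) ≃ₗ[ℤ] PlusInt V :=
  AddEquiv.toIntLinearEquiv (AddEquiv.refl (V × ℤ))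

/-- The projection to `V`. -/
def plusIntFst (V : Type*) [AddCommGroup V] : PlusInt V →ₗ[ℤ] V :=
  (AddMonoidHom.fst V ℤ).toIntLinearMap

/-- The projection to `ℤ`. -/
def plusIntSnd (V : Type*) [AddCommGroup V] : PlusInt V →ₗ[ℤ] ℤ :=
  (AddMonoidHom.snd V ℤ).toIntLinearMap

/-- The inclusion of `V`. -/
def plusIntInl (V : Type*) [AddCommGroup V] : V →ₗ[ℤ] PlusInt V :=
  (AddMonoidHom.inl V ℤ).toIntLinearMap

/-- The vector of norm one. -/
def plusIntOne (V : Type*) [AddCommGroup V] : PlusInt V := plusIntEquiv V (0, 1)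

@[simp] theorem plusIntFst_equiv (x : V × ℤ) : plusIntFst V (plusIntEquiv V x) = x.1 := rfl

@[simp] theorem plusIntSnd_equiv (x : V × ℤ) : plusIntSnd V (plusIntEquiv V x) = x.2 := rfl

@[simp] theorem plusIntFst_inl (v : V) : plusIntFst V (plusIntInl V v) = v := rfl

@[simp] theorem plusIntSnd_inl (v : V) : plusIntSnd V (plusIntInl V v) = 0 := rfl

@[simp] theorem plusIntFst_one : plusIntFst V (plusIntOne V) = 0 := rfl

@[simp] theorem plusIntSnd_one : plusIntSnd V (plusIntOne V) = 1 := rfl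

theorem plusInt_eq (x : PlusInt V) :
    plusIntInl V (plusIntFst V x) + plusIntSnd V x • plusIntOne V = x := by
  refine Prod.ext ?_ ?_
  · change plusIntFst V (_ + _) = plusIntFst V x
    simp
  · change plusIntSnd V (_ + _) = plusIntSnd V x
    simp

/-- The basis of `PlusInt V` extending a basis of `V`. -/
noncomputable def plusIntBasis {ι : Type*} (e : Module.Basis ι ℤ V) :
    Module.Basis (ι ⊕ Unit) ℤ (PlusInt V) :=
  (e.prod (Module.Basis.singleton Unit ℤ)).map (plusIntEquiv V)

instance [Module.Free ℤ V] : Module.Free ℤ (PlusInt V) :=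
  Module.Free.of_basis (plusIntBasis (Module.Free.chooseBasis ℤ V))

instance [Module.Finite ℤ V] : Module.Finite ℤ (PlusInt V) :=
  Module.Finite.equiv (plusIntEquiv V)

/-- The orthogonal sum of `B` and the form `⟨1⟩`. -/
noncomputable def addOne (B : LinearMap.BilinForm ℤ V) : LinearMap.BilinForm ℤ (PlusInt V) :=
  B.compl₁₂ (plusIntFst V) (plusIntFst V) +
    (LinearMap.mul ℤ ℤ).compl₁₂ (plusIntSnd V) (plusIntSnd V)

variable {B : LinearMap.BilinForm ℤ V}

theorem addOne_apply (x y : PlusInt V) :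
    addOne B x y = B (plusIntFst V x) (plusIntFst V y) + plusIntSnd V x * plusIntSnd V y := rfl

theorem isSymm_addOne (hB : B.IsSymm) : (addOne B).IsSymm :=
  ⟨fun x y => by rw [addOne_apply, addOne_apply, ← hB.eq, mul_comm]⟩

theorem det_toMatrix_addOne {ι : Type*} [Fintype ι] [DecidableEq ι] (e : Module.Basis ι ℤ V) :
    (LinearMap.BilinForm.toMatrix (plusIntBasis e) (addOne B)).det =
      (LinearMap.BilinForm.toMatrix e B).det := by
  have h : LinearMap.BilinForm.toMatrix (plusIntBasis e) (addOne B) =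
      Matrix.fromBlocks (LinearMap.BilinForm.toMatrix e B) 0 0 1 := by
    ext i j
    rw [LinearMap.BilinForm.toMatrix_apply, addOne_apply]
    rcases i with i | i <;> rcases j with j | j <;>
      simp [LinearMap.BilinForm.toMatrix_apply, plusIntBasis]
  rw [h, Matrix.det_fromBlocks_zero₂₁, Matrix.det_one, mul_one]

variable {T : Type*} [AddCommGroup T]

theorem IsTensor.addOne {N : Type*} [AddCommGroup N] {ψ : QuadraticMap ℤ T N}
    {Q : QuadraticMap ℤ (V ⊗[ℤ] T) N} (hQ : IsTensor B ψ Q) :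
    IsTensor (addOne B) ψ
      ((Q.comp (LinearMap.rTensor T (plusIntFst V)) : QuadraticMap ℤ (PlusInt V ⊗[ℤ] T) N) +
        (ψ.comp (contract T (plusIntSnd V)) : QuadraticMap ℤ (PlusInt V ⊗[ℤ] T) N)) := by
  set Q' : QuadraticMap ℤ (PlusInt V ⊗[ℤ] T) N :=
    (Q.comp (LinearMap.rTensor T (plusIntFst V)) : QuadraticMap ℤ (PlusInt V ⊗[ℤ] T) N) +
      (ψ.comp (contract T (plusIntSnd V)) : QuadraticMap ℤ (PlusInt V ⊗[ℤ] T) N)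
  have hQ' : ∀ z, Q' z = Q (LinearMap.rTensor T (plusIntFst V) z) +
      ψ (contract T (plusIntSnd V) z) := fun z => rfl
  refine ⟨fun v x => ?_, fun v w x y => ?_⟩
  · rw [hQ', LinearMap.rTensor_tmul, hQ.1, contract_tmul, QuadraticMap.map_smul, ← add_smul]
    rfl
  · have h1 : ∀ z z', QuadraticMap.polar Q' z z' =
        QuadraticMap.polar Q (LinearMap.rTensor T (plusIntFst V) z)
          (LinearMap.rTensor T (plusIntFst V) z') +
        QuadraticMap.polar ψ (contract T (plusIntSnd V) z) (contract T (plusIntSnd V) z') := by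
      intro z z'
      simp only [QuadraticMap.polar, hQ', map_add]
      abel
    rw [h1, LinearMap.rTensor_tmul, LinearMap.rTensor_tmul, hQ.2, contract_tmul, contract_tmul,
      QuadraticMap.polar_smul_left, QuadraticMap.polar_smul_right, ← mul_smul, ← add_smul]
    rfl

theorem bijective_plusInt_tensor (V T : Type*) [AddCommGroup V] [AddCommGroup T] :
    Function.Bijective fun z : PlusInt V ⊗[ℤ] T =>
      (LinearMap.rTensor T (plusIntFst V) z, contract T (plusIntSnd V) z) := by
  have h1 : ∀ z : PlusInt V ⊗[ℤ] T, LinearMap.rTensor T (plusIntInl V)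
      (LinearMap.rTensor T (plusIntFst V) z) +
      plusIntOne V ⊗ₜ[ℤ] contract T (plusIntSnd V) z = z := by
    intro z
    induction z using TensorProduct.induction_on with
    | zero => simp
    | tmul v t =>
      rw [LinearMap.rTensor_tmul, LinearMap.rTensor_tmul, contract_tmul,
        ← TensorProduct.smul_tmul, ← TensorProduct.add_tmul, plusInt_eq]
    | add a b ha hb =>
      conv_rhs => rw [← ha, ← hb]
      simp only [map_add, TensorProduct.tmul_add]
      abel
  refine ⟨fun a b hab => ?_, fun ⟨x, t⟩ => ?_⟩
  · simp only [Prod.mk.injEq] at hab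
    rw [← h1 a, ← h1 b, hab.1, hab.2]
  · refine ⟨LinearMap.rTensor T (plusIntInl V) x + plusIntOne V ⊗ₜ[ℤ] t, ?_⟩
    simp only [map_add, LinearMap.rTensor_tmul, contract_tmul]
    have h2 : LinearMap.rTensor T (plusIntFst V) (LinearMap.rTensor T (plusIntInl V) x) = x := by
      rw [← LinearMap.comp_apply, ← LinearMap.rTensor_comp]
      exact LinearMap.congr_fun (LinearMap.rTensor_id T V) x
    have h3 : contract T (plusIntSnd V) (LinearMap.rTensor T (plusIntInl V) x) = 0 := by
      clear h2
      induction x using TensorProduct.induction_on with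
      | zero => simp
      | tmul v s => simp [contract_tmul]
      | add a b ha hb => rw [map_add, map_add, ha, hb, add_zero]
    rw [h2, h3]
    simp

theorem gauss_addOne [Module.Free ℤ V] [Module.Finite ℤ V] [Finite T]
    {ψ : QuadraticMap ℤ T UnitAddCircle}
    {Q : QuadraticMap ℤ (V ⊗[ℤ] T) UnitAddCircle} (hQ : IsTensor B ψ Q) :
    ∃ Q', IsTensor (addOne B) ψ Q' ∧ gauss Q' = gauss Q * gauss ψ := by
  refine ⟨_, hQ.addOne, ?_⟩
  rw [← gauss_prod, ← gauss_comp_equiv (Equiv.ofBijective _ (bijective_plusInt_tensor V T))]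
  rfl

end AddOne

/-! ### The phase law for p = 2 -/

section LawTwo

variable {V : Type*} [AddCommGroup V] [Module.Free ℤ V] [Module.Finite ℤ V]
  {B : LinearMap.BilinForm ℤ V} {ι : Type*} [Fintype ι] [DecidableEq ι]
  {T : Type*} [AddCommGroup T] [Finite T]

theorem tensor_uForm_two (hB : B.IsSymm) {Q : QuadraticMap ℤ (V ⊗[ℤ] ZMod 2) UnitAddCircle}
    (hQ : IsTensor B (uForm 2 even_two) Q) : gauss Q = gauss (reductionForm B 2) := by
  congr 1
  ext z
  obtain ⟨v, rfl⟩ := tmul_one_surjective V 2 z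
  have h := uForm_intCast 2 even_two 1
  rw [Int.cast_one] at h
  rw [hQ.1, reductionForm_tmul_one B hB 2 even_two, h, ← AddCircle.coe_zsmul]
  congr 1
  rw [zsmul_eq_mul]
  push_cast
  ring

theorem dir_gauss_uForm (m : ℕ) [NeZero m] (hm : Even m) :
    dir (gauss (uForm m hm)) = AddCircle.toCircle ((1 / 8 : ℝ) : UnitAddCircle) := by
  rw [gauss_uForm, dir_ofReal_mul, dir_toCircle]
  exact Real.sqrt_pos.mpr (by exact_mod_cast Nat.pos_of_ne_zero (NeZero.ne m))

theorem gauss_uForm_ne_zero (m : ℕ) [NeZero m] (hm : Even m) : gauss (uForm m hm) ≠ 0 := by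
  rw [gauss_uForm]
  refine mul_ne_zero ?_ (Circle.coe_ne_zero _)
  exact_mod_cast (Real.sqrt_pos.mpr (by exact_mod_cast Nat.pos_of_ne_zero (NeZero.ne m))).ne'

theorem IsFrame.dir_gauss_addOne {n : ℕ} {w : Fin n → PlusInt V} (hw : IsFrame (addOne B) w)
    (hw2 : ∀ i, ¬ 2 ∣ addOne B (w i) (w i))
    (hχ : ZMod.χ₈ ((∏ i, addOne B (w i) (w i) : ℤ) : ZMod 8) = 1) {k : ℕ}
    (hT : ∀ t : T, ((2 : ℤ) ^ k) • t = 0) {ψ : QuadraticMap ℤ T UnitAddCircle}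
    (hG : gauss ψ ≠ 0) {Q : QuadraticMap ℤ (V ⊗[ℤ] T) UnitAddCircle} (hQ : IsTensor B ψ Q) :
    dir (gauss Q) * dir (gauss ψ) =
      dir (gauss ψ) ^ (∑ i, ZMod.χ₄ (addOne B (w i) (w i) : ℤ)) := by
  obtain ⟨Q', hQ', hG'⟩ := gauss_addOne hQ
  have hD2 : ¬ 2 ∣ frameDet (addOne B) w := fun h => by
    obtain ⟨i, -, hi⟩ := (Int.prime_two.dvd_finsetProd_iff _).mp h
    exact hw2 i hi
  rw [← dir_mul, ← hG', hw.gauss_isTensor hT (isCoprime_two_pow hD2) hQ',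
    dir_prod_gauss_odd hT hG hw2 hχ]

theorem phaseLaw_two (hB : B.IsSymm) (e : Module.Basis ι ℤ V)
    (hdet : (LinearMap.BilinForm.toMatrix e B).det = 1 ∨
      (LinearMap.BilinForm.toMatrix e B).det = -1) {k : ℕ}
    (hT : ∀ t : T, ((2 : ℤ) ^ k) • t = 0) {ψ : QuadraticMap ℤ T UnitAddCircle}
    (hG : gauss ψ ≠ 0) : PhaseLaw B ψ := by
  have hdet' := hdet
  rw [← det_toMatrix_addOne e] at hdet'
  obtain ⟨n, w, hw, hw2⟩ := exists_frame_odd (isSymm_addOne hB)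
    ((isUnimodular_of_det _ hdet').nondegMod 2) ⟨plusIntOne V, by simp [addOne_apply]⟩
  -- The product of the norms is ±c² with c odd, hence ±1 modulo 8.
  have hχ : ZMod.χ₈ ((∏ i, addOne B (w i) (w i) : ℤ) : ZMod 8) = 1 := by
    obtain ⟨-, c, hc⟩ := hw.frameDet_eq (plusIntBasis e)
    have hD2 : ¬ 2 ∣ frameDet (addOne B) w := fun h => by
      obtain ⟨i, -, hi⟩ := (Int.prime_two.dvd_finsetProd_iff _).mp h
      exact hw2 i hi
    change ZMod.χ₈ ((frameDet (addOne B) w : ℤ) : ZMod 8) = 1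
    have hc2 : ¬ 2 ∣ c := by
      intro h
      rw [hc] at hD2
      exact hD2 ((h.pow two_ne_zero).mul_right _)
    have hc8 : ((c : ℤ) : ZMod 8) ^ 2 = 1 := by
      obtain ⟨a, rfl⟩ : ∃ a, c = 2 * a + 1 := ⟨c / 2, by omega⟩
      push_cast
      generalize (a : ZMod 8) = x
      revert x
      decide
    rw [hc, Int.cast_mul, Int.cast_pow, hc8, one_mul]
    rcases hdet' with h | h <;> rw [h] <;> decide
  set s := ∑ i, ZMod.χ₄ (addOne B (w i) (w i) : ℤ) with hs
  -- The frame does not depend on ψ, so s may be found from the single example u_2: there u =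
  -- e^(2πi/8) is primitive of order 8, and B ⊗ u_2 is the function in Brown's formula.
  have hs8 : (8 : ℤ) ∣ s - 1 - signature B := by
    obtain ⟨Q, hQ⟩ := exists_isTensor B hB (uForm 2 even_two)
    have h1 := hw.dir_gauss_addOne hw2 hχ (k := 1)
      (fun t : ZMod 2 => by revert t; decide) (gauss_uForm_ne_zero 2 even_two) hQ
    rw [tensor_uForm_two hB hQ, (gauss_reductionForm hB (isUnimodular_of_det e hdet)).2,
      dir_gauss_uForm, ← Circle.coe_mul, ← AddCircle.toCircle_add, ← Circle.coe_zpow,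
      ← AddCircle.toCircle_zsmul, Circle.coe_inj] at h1
    have h2 := AddCircle.injective_toCircle one_ne_zero h1
    rw [← sub_eq_zero, ← AddCircle.coe_zsmul, ← AddCircle.coe_add, ← AddCircle.coe_sub,
      AddCircle.coe_eq_zero_iff] at h2
    obtain ⟨l, hl⟩ := h2
    rw [zsmul_eq_mul, zsmul_eq_mul, ← hs] at hl
    refine ⟨-l, ?_⟩
    have h3 : ((s - 1 - signature B : ℤ) : ℝ) = ((8 * -l : ℤ) : ℝ) := by
      push_cast
      linarith
    exact_mod_cast h3
  have hu8 := dir_pow_eight hT hG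
  refine ⟨hu8, fun Q hQ => ?_⟩
  have hu0 := dir_ne_zero hG
  have h1 := hw.dir_gauss_addOne hw2 hχ hT hG hQ
  obtain ⟨l, hl⟩ := hs8
  have h2 : s = signature B + 1 + 8 * l := by linarith
  have hu8z : dir (gauss ψ) ^ (8 : ℤ) = 1 := by exact_mod_cast hu8
  rw [← hs, h2, zpow_add₀ hu0, zpow_add₀ hu0, zpow_mul, hu8z, one_zpow, mul_one, zpow_one] at h1
  exact mul_right_cancel₀ hu0 h1

end LawTwo

/-! ### Reduction to primary groups -/

section Splitting

variable {V : Type*} [AddCommGroup V] {T : Type*} [AddCommGroup T]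

theorem polar_eq_zero_of_isCoprime {M N : Type*} [AddCommGroup M] [AddCommGroup N]
    (Q : QuadraticMap ℤ M N) {a b : ℤ} (hab : IsCoprime a b) {x y : M} (hx : a • x = 0)
    (hy : b • y = 0) : QuadraticMap.polar Q x y = 0 := by
  refine eq_zero_of_zsmul_of_isCoprime hab ?_ ?_
  · rw [← QuadraticMap.polar_smul_left, hx, QuadraticMap.polar_zero_left]
  · rw [← QuadraticMap.polar_smul_right, hy, QuadraticMap.polar_zero_right]

theorem bijective_torsionBy_add {a b : ℤ} (hab : IsCoprime a b) (hT : ∀ t : T, (a * b) • t = 0) :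
    Function.Bijective fun x : Submodule.torsionBy ℤ T a × Submodule.torsionBy ℤ T b =>
      (x.1 + x.2 : T) := by
  constructor
  · rintro ⟨x, y⟩ ⟨x', y'⟩ h
    simp only at h
    have hx : ((x - x' : Submodule.torsionBy ℤ T a) : T) =
        ((y' - y : Submodule.torsionBy ℤ T b) : T) := by
      push_cast
      rw [sub_eq_sub_iff_add_eq_add, h, add_comm]
    have h1 : ((x - x' : Submodule.torsionBy ℤ T a) : T) = 0 :=
      eq_zero_of_zsmul_of_isCoprime hab (x - x').2 (by rw [hx]; exact (y' - y).2)
    have h2 : ((y' - y : Submodule.torsionBy ℤ T b) : T) = 0 := hx.symm.trans h1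
    have h3 : x = x' := sub_eq_zero.mp (Subtype.ext h1)
    have h4 : y' = y := sub_eq_zero.mp (Subtype.ext h2)
    rw [h3, h4]
  · intro t
    have ⟨u, v, huv⟩ := hab
    refine ⟨⟨⟨(v * b) • t, ?_⟩, ⟨(u * a) • t, ?_⟩⟩, ?_⟩
    · rw [Submodule.mem_torsionBy_iff, ← mul_smul, mul_left_comm, mul_smul, hT, smul_zero]
    · rw [Submodule.mem_torsionBy_iff, ← mul_smul, mul_left_comm, mul_comm b a, mul_smul, hT,
        smul_zero]
    · simp only
      rw [← add_smul, add_comm, huv, one_smul]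

theorem IsTensor.comp_lTensor {B : LinearMap.BilinForm ℤ V} {N : Type*} [AddCommGroup N]
    {ψ : QuadraticMap ℤ T N} {Q : QuadraticMap ℤ (V ⊗[ℤ] T) N} (hQ : IsTensor B ψ Q) {S : Type*}
    [AddCommGroup S] (f : S →ₗ[ℤ] T) :
    IsTensor B (ψ.comp f) (Q.comp (LinearMap.lTensor V f)) := by
  refine ⟨fun v x => hQ.1 v (f x), fun v w x y => ?_⟩
  have := hQ.2 v w (f x) (f y)
  simp only [QuadraticMap.polar] at this ⊢
  simp only [QuadraticMap.comp_apply, map_add]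
  exact this

variable [Module.Free ℤ V]

theorem bijective_lTensor_torsionBy_add {a b : ℤ} (hab : IsCoprime a b)
    (hT : ∀ t : T, (a * b) • t = 0) :
    Function.Bijective fun x : (V ⊗[ℤ] Submodule.torsionBy ℤ T a) ×
        (V ⊗[ℤ] Submodule.torsionBy ℤ T b) =>
      LinearMap.lTensor V (Submodule.torsionBy ℤ T a).subtype x.1 +
        LinearMap.lTensor V (Submodule.torsionBy ℤ T b).subtype x.2 := by
  have hinj : ∀ c : ℤ, Function.Injective
      (LinearMap.lTensor V (Submodule.torsionBy ℤ T c).subtype) := fun c =>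
    Module.Flat.lTensor_preserves_injective_linearMap _ (Submodule.injective_subtype _)
  have hkill : ∀ (c : ℤ) (x : V ⊗[ℤ] Submodule.torsionBy ℤ T c), c • x = 0 := fun c x =>
    tensor_zsmul_eq_zero (fun t => Subtype.ext t.2) x
  constructor
  · rintro ⟨x, y⟩ ⟨x', y'⟩ h
    simp only at h
    have hx : LinearMap.lTensor V (Submodule.torsionBy ℤ T a).subtype (x - x') =
        LinearMap.lTensor V (Submodule.torsionBy ℤ T b).subtype (y' - y) := by
      rw [map_sub, map_sub, sub_eq_sub_iff_add_eq_add, h, add_comm]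
    have h1 : LinearMap.lTensor V (Submodule.torsionBy ℤ T a).subtype (x - x') = 0 :=
      eq_zero_of_zsmul_of_isCoprime hab (by rw [← map_smul, hkill, map_zero])
        (by rw [hx, ← map_smul, hkill, map_zero])
    have h2 := hx.symm.trans h1
    have h3 : x = x' := sub_eq_zero.mp (hinj a (h1.trans (map_zero _).symm))
    have h4 : y' = y := sub_eq_zero.mp (hinj b (h2.trans (map_zero _).symm))
    rw [h3, h4]
  · intro z
    induction z using TensorProduct.induction_on with
    | zero => exact ⟨0, by simp⟩
    | tmul v t =>
      obtain ⟨⟨x, y⟩, rfl⟩ := (bijective_torsionBy_add hab hT).2 t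
      exact ⟨(v ⊗ₜ x, v ⊗ₜ y), by simp [TensorProduct.tmul_add]⟩
    | add z z' hz hz' =>
      obtain ⟨x, rfl⟩ := hz
      obtain ⟨y, rfl⟩ := hz'
      refine ⟨x + y, ?_⟩
      simp only [Prod.fst_add, Prod.snd_add, map_add]
      abel

variable [Module.Finite ℤ V] [Finite T]

/-- Torsion parts of coprime orders are orthogonal, so G(ψ) and G(B ⊗ ψ) both factor, and the law is
multiplicative in u. -/
theorem phaseLaw_of_torsionBy {B : LinearMap.BilinForm ℤ V} {a b : ℤ} (hab : IsCoprime a b)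
    (hT : ∀ t : T, (a * b) • t = 0) {ψ : QuadraticMap ℤ T UnitAddCircle}
    (h₁ : PhaseLaw B (ψ.comp (Submodule.torsionBy ℤ T a).subtype))
    (h₂ : PhaseLaw B (ψ.comp (Submodule.torsionBy ℤ T b).subtype)) : PhaseLaw B ψ := by
  have hG : gauss ψ = gauss (ψ.comp (Submodule.torsionBy ℤ T a).subtype) *
      gauss (ψ.comp (Submodule.torsionBy ℤ T b).subtype) := by
    rw [← gauss_prod, ← gauss_comp_equiv (Equiv.ofBijective _ (bijective_torsionBy_add hab hT))]
    congr 1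
    ext ⟨x, y⟩
    rw [Equiv.ofBijective_apply, QuadraticMap.map_add ψ,
      polar_eq_zero_of_isCoprime ψ hab x.2 y.2, add_zero]
    rfl
  refine ⟨by rw [hG, dir_mul, mul_pow, h₁.pow_eight, h₂.pow_eight, one_mul], fun Q hQ => ?_⟩
  have hGQ : gauss Q =
      gauss (Q.comp (LinearMap.lTensor V (Submodule.torsionBy ℤ T a).subtype)) *
      gauss (Q.comp (LinearMap.lTensor V (Submodule.torsionBy ℤ T b).subtype)) := by
    rw [← gauss_prod,
      ← gauss_comp_equiv (Equiv.ofBijective _ (bijective_lTensor_torsionBy_add (V := V) hab hT))]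
    congr 1
    ext ⟨x, y⟩
    have hkill : ∀ (c : ℤ) (x : V ⊗[ℤ] Submodule.torsionBy ℤ T c), c • x = 0 := fun c x =>
      tensor_zsmul_eq_zero (fun t => Subtype.ext t.2) x
    rw [Equiv.ofBijective_apply, QuadraticMap.map_add Q,
      polar_eq_zero_of_isCoprime Q hab (by rw [← map_smul, hkill, map_zero])
        (by rw [← map_smul, hkill, map_zero]), add_zero]
    rfl
  rw [hG, hGQ, dir_mul, dir_mul, mul_zpow]
  exact congrArg₂ (· * ·) (h₁.tensor _ (hQ.comp_lTensor _)) (h₂.tensor _ (hQ.comp_lTensor _))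

omit [Finite T] in
theorem IsTame.comp_torsionBy {a b : ℤ} (hab : IsCoprime a b) (hT : ∀ t : T, (a * b) • t = 0)
    {ψ : QuadraticMap ℤ T UnitAddCircle} (hψ : IsTame ψ) :
    IsTame (ψ.comp (Submodule.torsionBy ℤ T a).subtype) := by
  intro x hx
  refine hψ _ fun s => ?_
  obtain ⟨⟨y, z⟩, rfl⟩ := (bijective_torsionBy_add hab hT).2 s
  simp only
  rw [QuadraticMap.polar_add_right]
  have h1 := polar_eq_zero_of_isCoprime ψ hab x.2 z.2
  have h2 : QuadraticMap.polar ψ x y = 0 := hx y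
  exact (congrArg₂ (· + ·) h2 h1).trans (add_zero 0)

theorem phaseLaw_of_zsmul_eq_zero {B : LinearMap.BilinForm ℤ V} (hB : B.IsSymm)
    {ι : Type*} [Fintype ι] [DecidableEq ι] (e : Module.Basis ι ℤ V)
    (hdet : (LinearMap.BilinForm.toMatrix e B).det = 1 ∨
      (LinearMap.BilinForm.toMatrix e B).det = -1) {n : ℕ} (hn : n ≠ 0)
    (hT : ∀ t : T, (n : ℤ) • t = 0) {ψ : QuadraticMap ℤ T UnitAddCircle} (hψ : IsTame ψ) :
    PhaseLaw B ψ := by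
  induction n using Nat.recOnPrimeCoprime generalizing T with
  | zero => exact absurd rfl hn
  | prime_pow p k hp =>
    have : Fact p.Prime := ⟨hp⟩
    push_cast at hT
    by_cases h2 : p = 2
    · subst h2
      exact phaseLaw_two hB e hdet hT hψ.gauss_ne_zero
    · exact phaseLaw_odd_prime hB e hdet h2 hT hψ.gauss_ne_zero
  | coprime a b ha hb hab iha ihb =>
    have hab' : IsCoprime (a : ℤ) b := Nat.isCoprime_iff_coprime.mpr hab
    push_cast at hT
    refine phaseLaw_of_torsionBy hab' hT ?_ ?_
    · exact iha (by omega) (fun t => Subtype.ext t.2) (hψ.comp_torsionBy hab' hT)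
    · exact ihb (by omega) (fun t => Subtype.ext t.2)
        (hψ.comp_torsionBy hab'.symm (by simpa only [mul_comm] using hT))

end Splitting

/-- The bilinear form xy/m is nondegenerate, as pairing with 1 already shows. -/
theorem isTame_uForm (m : ℕ) [NeZero m] (hm : Even m) : IsTame (uForm m hm) := by
  intro t ht
  have h1 : ZMod.toAddCircle (t * 1) = 0 := (polar_half_sq hm t 1).symm.trans (ht 1)
  rw [mul_one] at h1
  have h2 : t = 0 := ZMod.toAddCircle_injective m (h1.trans (map_zero _).symm)
  rw [h2, QuadraticMap.map_zero]

end GaussSums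

theorem theorem2p4 {V : Type*} [AddCommGroup V] [Module.Free ℤ V] [Module.Finite ℤ V]
    (B : LinearMap.BilinForm ℤ V) (hB : B.IsSymm)
    {ι : Type*} [Fintype ι] [DecidableEq ι] (e : Module.Basis ι ℤ V)
    (hdet : (LinearMap.BilinForm.toMatrix e B).det = 1 ∨
      (LinearMap.BilinForm.toMatrix e B).det = -1) :
    (∀ {T : Type*} [AddCommGroup T] [Finite T] (ψ : QuadraticMap ℤ T UnitAddCircle),
      GaussSums.IsTame ψ →
        GaussSums.IsTame (GaussSums.tensor B hB ψ) ∧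
        GaussSums.gauss ψ ≠ 0 ∧
        GaussSums.gauss (GaussSums.tensor B hB ψ) ≠ 0 ∧
        GaussSums.phase ψ ∈ GaussSums.ratModInt ∧
        GaussSums.phase (GaussSums.tensor B hB ψ) ∈ GaussSums.ratModInt ∧
        GaussSums.phase (GaussSums.tensor B hB ψ) =
          GaussSums.signature B • GaussSums.phase ψ) ∧
    (∀ (m : ℕ) [NeZero m] (hm : Even m),
      GaussSums.IsTame (GaussSums.uForm m hm) ∧
      GaussSums.gauss (GaussSums.uForm m hm) ≠ 0 ∧
      GaussSums.phase (GaussSums.uForm m hm) = ((1 / 8 : ℝ) : UnitAddCircle)) ∧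
    GaussSums.gauss (GaussSums.reductionForm B 2) ≠ 0 ∧
    GaussSums.phase (GaussSums.reductionForm B 2) =
      ((GaussSums.signature B / 8 : ℝ) : UnitAddCircle) := by
  have hU := GaussSums.isUnimodular_of_det e hdet
  obtain ⟨h3, h3'⟩ := GaussSums.gauss_reductionForm hB hU
  refine ⟨fun {T} _ _ ψ hψ => ?_, fun m _ hm => ⟨GaussSums.isTame_uForm m hm,
    GaussSums.gauss_uForm_ne_zero m hm, GaussSums.phase_eq_of_dir
      (GaussSums.gauss_uForm_ne_zero m hm) (GaussSums.dir_gauss_uForm m hm)⟩,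
    h3, GaussSums.phase_eq_of_dir h3 h3'⟩
  have hQ := GaussSums.isTensor_tensor B hB ψ
  have hG := hψ.gauss_ne_zero
  have hψQ := hQ.isTame hB hU hψ
  have hGQ := hψQ.gauss_ne_zero
  have hlaw := GaussSums.phaseLaw_of_zsmul_eq_zero hB e hdet (Nat.card_pos (α := T)).ne'
    (fun t => by rw [natCast_zsmul]; exact card_nsmul_eq_zero') hψ
  have hdir := hlaw.tensor _ hQ
  refine ⟨hψQ, hG, hGQ, GaussSums.phase_mem_ratModInt hG (by norm_num) hlaw.pow_eight,
    GaussSums.phase_mem_ratModInt hGQ (n := 8) (by norm_num) ?_, GaussSums.phase_eq_of_dir hGQ ?_⟩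
  · rw [hdir, ← zpow_natCast, ← zpow_mul, mul_comm, zpow_mul, zpow_natCast, hlaw.pow_eight,
      one_zpow]
  · rw [hdir, ← GaussSums.toCircle_phase hG, AddCircle.toCircle_zsmul, Circle.coe_zpow]
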